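/- **Setting.** For each dimension $P$, let $\mathcal D_F$ be an input distribution on $\mathbb R^P$ with finite second moments and covariance $\Sigma=\mathbb E[xx^T]$, and let $\mathcal D_W$ be a distribution of pairs $(\beta_1,\beta_2)$ of vectors in $\mathbb R^P$. *Power-law scaling* with exponents $\gamma,\delta>0$ and correlation $\rho\in[0,1)$ means that $\Sigma$ has eigenvalues $\lambda_i=i^{-1-\gamma}$ with orthonormal eigenvectors $v_i$, that $\mathbb E_{\mathcal D_W}[\langle\beta_j,v_i\rangle^2]=i^{-\delta}$ for $j=1,2$, and that $\mathbb E_{\mathcal D_W}[\langle\beta_1,v_i\rangle\langle\beta_2,v_i\rangle]=\rho\, i^{-\delta}$, for $1\le i\le P$. For $\lambda\in(0,1)$ and a dataset size $N\in\{1,2,\dots\}\cup\{\infty\}$ (with $1/\infty=0$), let $\kappa>0$ be the solution of $\frac{\lambda}{\kappa}+\frac1N\mathrm{Tr}(\Sigma\Sigma_\kappa^{-1})=1$, where $\Sigma_\kappa=\Sigma+\kappa I$. For $\alpha\in[0,1]$ put $L_1^*=(T_1+T_2+T_3+T_4+T_5)/Q$ with $B=(\beta_1-\beta_2)(\beta_1-\beta_2)^T$,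 $M=(\beta_1-\beta_2)\beta_1^T$, $d=\frac1N\mathrm{Tr}(\Sigma^2\Sigma_\kappa^{-2})$, $Q=1-d$ and $$T_1=\kappa^2\mathrm{Tr}(\Sigma\Sigma_\kappa^{-2}\beta_1\beta_1^T),\quad T_2=(1-\alpha)^2\mathrm{Tr}(\Sigma_\kappa^{-2}\Sigma^3B),\quad T_3=2(1-\alpha)\kappa\,\mathrm{Tr}(\Sigma_\kappa^{-2}\Sigma^2M),$$ $$T_4=-2(1-\alpha)\kappa\, d\,\mathrm{Tr}(\Sigma_\kappa^{-1}\Sigma M),\quad T_5=(1-\alpha)\,d\,\big(\mathrm{Tr}(\Sigma B)-2(1-\alpha)\mathrm{Tr}(\Sigma_\kappa^{-1}\Sigma^2B)\big)$$ (the deterministic equivalent of the performance loss of ridge regression on $N$ points, a fraction $\alpha$ of them labelled by $\beta_1$ and the rest by $\beta_2$). Let $L_2^*(\alpha)=\mathbb E_x[\langle\beta_2-\beta(\alpha),x\rangle^2]$ with $\beta(\alpha)=\arg\min_\beta\big(\alpha\,\mathbb E_x\langle\beta-\beta_1,x\rangle^2+(1-\alpha)\,\mathbb E_x\langle\beta-\beta_2,x\rangle^2\big)$.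 Expectations over $\mathcal D_W$ are taken at $P=\infty$, i.e. in the limit $P\to\infty$. A company with $N$ data points and safety constraint $\tau$ has performance loss $\mathcal L(N,\tau)=\inf\mathbb E_{\mathcal D_W}[L_1^*]$ over $\alpha\in[0.5,1]$, $\lambda\in(0,1)$ with $\mathbb E_{\mathcal D_W}[L_2^*(\alpha)]\le\tau$. The incumbent has infinite data and constraint $\tau_I$, the entrant has constraint $\tau_E$, and the market-entry threshold is $N_E^*=\min\{N\in\mathbb Z_{\ge1}:\mathcal L(N,\tau_E)\le\mathcal L(\infty,\tau_I)\}$ ($\infty$ if there is no such $N$). **Theorem.** Suppose that power-law scaling holds with $\gamma,\delta>0$, $\rho\in[0,1)$ and $P=\infty$, that $\delta\ne2+\gamma$, and that $\tau_E>\tau_I\ge\mathbb E_{\mathcal D_W}[L_2^*(0.75)]$. Let $L^*(\rho)=\mathbb E_{\mathcal D_W}[(\beta_1-\beta_2)^T\Sigma(\beta_1-\beta_2)]$, $\nu=\min(2(1+\gamma),\delta+\gamma)$, $\nu'=\min(1+\gamma,\delta+\gamma)$, $G_I=(\sqrt{L^*(\rho)}-\sqrt{\min(\tau_I,L^*(\rho))})^2$,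 $G_E=(\sqrt{L^*(\rho)}-\sqrt{\min(\tau_E,L^*(\rho))})^2$ and $D=G_I-G_E$. Then the limits $P\to\infty$ exist, $L^*(\rho)=\Theta(1-\rho)$ and $D\ge0$. If $D=0$, then $N_E^*=\infty$. If $D>0$, then $N_E^*$ is finite and $$N_E^*=\begin{cases}\Theta\big(D^{-\frac1\nu}\big)&\text{if } D\ge G_E^{\frac12}(1-\rho)^{\frac12},\\[3pt] \Theta\big(D^{-\frac{\nu+1}{\nu}}G_E^{\frac12}(1-\rho)^{\frac12}\big)&\text{if } G_E^{\frac{\nu}{2(\nu-\nu')}}(1-\rho)^{\frac{\nu}{2(\nu-\nu')}}\le D\le G_E^{\frac12}(1-\rho)^{\frac12}\text{ and }\delta\neq1,\\[3pt] \Theta\Big(\big(D\,G_E^{-\frac12}(1-\rho)^{-\frac12}\big)^{-\frac{\nu'+1}{\nu'}}\Big)&\text{if } \delta>1\text{ and }D\le G_E^{\frac{\nu}{2(\nu-\nu')}}(1-\rho)^{\frac{\nu}{2(\nu-\nu')}},\end{cases}$$ where for $\delta<1$ (so that $\nu=\nu'$) there is no third regime and the second one has no lower boundary. The constants in $\Theta$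 depend only on $\gamma$ and $\delta$. -/

import Mathlib

open MeasureTheory Filter Topology

namespace MarketEntry

/-- The parameter space `ℝ^P` with its Euclidean structure. -/
abbrev Vec (P : ℕ) : Type := EuclideanSpace ℝ (Fin P)

/-- The covariance matrix `Σ = E[x xᵀ]` of the input distribution `DF`. -/
noncomputable def covMatrix {P : ℕ} (DF : Measure (Vec P)) : Matrix (Fin P) (Fin P) ℝ :=
  Matrix.of fun i j => ∫ x, x i * x j ∂DF

/-- The population loss `E_x[(⟨θ, x⟩ - ⟨β, x⟩)²]` of the linear predictor `β` against the target
`θ`. It is the performance loss `L₁(β)` for `θ = β₁`, the safety loss `L₂(β)` for `θ = β₂`. -/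
noncomputable def popLoss {P : ℕ} (DF : Measure (Vec P)) (θ β : Vec P) : ℝ :=
  ∫ x, (inner ℝ θ x - inner ℝ β x) ^ 2 ∂DF

/-- The infinite-data ridgeless regression estimator `β(α, 0)`: the minimizer of
`α E⟨β - β₁, x⟩² + (1 - α) E⟨β - β₂, x⟩²` (unique when the covariance is positive definite). -/
noncomputable def ridgeless {P : ℕ} (DF : Measure (Vec P)) (β₁ β₂ : Vec P) (α : ℝ) : Vec P :=
  Classical.epsilon fun β => ∀ β' : Vec P,
    α * popLoss DF β₁ β + (1 - α) * popLoss DF β₂ β ≤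
      α * popLoss DF β₁ β' + (1 - α) * popLoss DF β₂ β'

/-- The safety violation `L₂*`: the safety loss of the infinite-data ridgeless estimator. -/
noncomputable def safetyLoss {P : ℕ} (DF : Measure (Vec P)) (β₁ β₂ : Vec P) (α : ℝ) : ℝ :=
  popLoss DF β₂ (ridgeless DF β₁ β₂ α)

/-- The reciprocal `1 / N` of a dataset size, equal to `0` for infinite data. -/
noncomputable def recip (N : ℕ∞) : ℝ :=
  if N = ⊤ then 0 else 1 / (N.toNat : ℝ)

/-- The effective regularizer `κ(l, N, S)`: the unique `κ > 0` such that
`l / κ + (1 / N) Tr(S (S + κ I)⁻¹) = 1` (here `l > 0` is the ridge regularizer and `S` is positive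
semidefinite; the infimum is over a set with one element). -/
noncomputable def effReg {P : ℕ} (l : ℝ) (N : ℕ∞) (S : Matrix (Fin P) (Fin P) ℝ) : ℝ :=
  sInf {κ : ℝ | 0 < κ ∧ l / κ + recip N * (S * (S + κ • 1)⁻¹).trace = 1}

/-- The performance loss `L₁*`: the deterministic equivalent `(T₁ + T₂ + T₃ + T₄ + T₅) / Q` of the
performance loss of ridge regression with regularizer `l` on `N` data points, a fraction `α` of
which is labelled by `β₁` and the rest by `β₂`. -/
noncomputable def detLoss {P : ℕ} (DF : Measure (Vec P)) (β₁ β₂ : Vec P)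
    (l : ℝ) (N : ℕ∞) (α : ℝ) : ℝ :=
  let S := covMatrix DF
  let κ := effReg l N S
  let R := (S + κ • 1)⁻¹
  let A := Matrix.vecMulVec β₁.ofLp β₁.ofLp
  let B := Matrix.vecMulVec (β₁ - β₂).ofLp (β₁ - β₂).ofLp
  let M := Matrix.vecMulVec (β₁ - β₂).ofLp β₁.ofLp
  let df := recip N * (S ^ 2 * R ^ 2).trace
  let T₁ := κ ^ 2 * (S * R ^ 2 * A).trace
  let T₂ := (1 - α) ^ 2 * (R ^ 2 * S ^ 3 * B).trace
  let T₃ := 2 * (1 - α) * κ * (R ^ 2 * S ^ 2 * M).trace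
  let T₄ := -2 * (1 - α) * κ * df * (R * S * M).trace
  let T₅ := (1 - α) * df * ((S * B).trace - 2 * (1 - α) * (R * S ^ 2 * B).trace)
  let Q := 1 - df
  (T₁ + T₂ + T₃ + T₄ + T₅) / Q

/-- Power-law scaling in dimension `P`: the covariance has eigenvalues `i^(-1-γ)` with orthonormal
eigenvectors `vᵢ`, and `E⟨βⱼ, vᵢ⟩² = i^(-δ)`, `E[⟨β₁, vᵢ⟩ ⟨β₂, vᵢ⟩] = ρ i^(-δ)`, for `1 ≤ i ≤ P`
(the index `i : Fin P` starts at `0`, so it stands for `i + 1`). -/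
structure PowerLaw {P : ℕ} (γ δ ρ : ℝ) (DF : Measure (Vec P)) (DW : Measure (Vec P × Vec P)) :
    Prop where
  prob_input : IsProbabilityMeasure DF
  prob_target : IsProbabilityMeasure DW
  finite_second_moment : MemLp (fun x : Vec P => x) 2 DF
  scaling : ∃ v : OrthonormalBasis (Fin P) ℝ (Vec P), ∀ i : Fin P,
    Matrix.toEuclideanLin (covMatrix DF) (v i) = ((i : ℝ) + 1) ^ (-1 - γ) • v i ∧
    ∫ b, inner ℝ b.1 (v i) ^ 2 ∂DW = ((i : ℝ) + 1) ^ (-δ) ∧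
    ∫ b, inner ℝ b.2 (v i) ^ 2 ∂DW = ((i : ℝ) + 1) ^ (-δ) ∧
    ∫ b, inner ℝ b.1 (v i) * inner ℝ b.2 (v i) ∂DW = ρ * ((i : ℝ) + 1) ^ (-δ)

/-- `E_{DW}[L₁*]` in dimension `P`. -/
noncomputable def meanLoss {P : ℕ} (DF : Measure (Vec P)) (DW : Measure (Vec P × Vec P))
    (l : ℝ) (N : ℕ∞) (α : ℝ) : ℝ :=
  ∫ b, detLoss DF b.1 b.2 l N α ∂DW

/-- `E_{DW}[L₂*]` in dimension `P`. -/
noncomputable def meanSafety {P : ℕ} (DF : Measure (Vec P)) (DW : Measure (Vec P × Vec P))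
    (α : ℝ) : ℝ :=
  ∫ b, safetyLoss DF b.1 b.2 α ∂DW

/-- `E_{DW}[(β₁ - β₂)ᵀ Σ (β₁ - β₂)]` in dimension `P`. -/
noncomputable def meanGap {P : ℕ} (DF : Measure (Vec P)) (DW : Measure (Vec P × Vec P)) : ℝ :=
  ∫ b, (b.1 - b.2).ofLp ⬝ᵥ (covMatrix DF).mulVec (b.1 - b.2).ofLp ∂DW

section Limit

/-! The overparameterized limit `P = ∞`: the quantities of a sequence of problems, one in each
dimension `P`, in the limit `P → ∞`. -/

/-- `E_{DW}[L₁*]` at `P = ∞`. -/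
noncomputable def limLoss (DF : (P : ℕ) → Measure (Vec P))
    (DW : (P : ℕ) → Measure (Vec P × Vec P)) (l : ℝ) (N : ℕ∞) (α : ℝ) : ℝ :=
  limUnder atTop fun P : ℕ => meanLoss (DF P) (DW P) l N α

/-- `E_{DW}[L₂*]` at `P = ∞`. -/
noncomputable def limSafety (DF : (P : ℕ) → Measure (Vec P))
    (DW : (P : ℕ) → Measure (Vec P × Vec P)) (α : ℝ) : ℝ :=
  limUnder atTop fun P : ℕ => meanSafety (DF P) (DW P) α

/-- `L*(ρ) = E_{DW}[(β₁ - β₂)ᵀ Σ (β₁ - β₂)]` at `P = ∞`. -/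
noncomputable def limGap (DF : (P : ℕ) → Measure (Vec P))
    (DW : (P : ℕ) → Measure (Vec P × Vec P)) : ℝ :=
  limUnder atTop fun P : ℕ => meanGap (DF P) (DW P)

/-- The performance loss of a company with `N` data points and safety constraint `τ`, which chooses
`α ∈ [0.5, 1]` and `l ∈ (0, 1)` optimally (as an infimum) subject to its safety constraint. -/
noncomputable def companyLoss (DF : (P : ℕ) → Measure (Vec P))
    (DW : (P : ℕ) → Measure (Vec P × Vec P)) (N : ℕ∞) (τ : ℝ) : ℝ :=
  sInf {L : ℝ | ∃ α ∈ Set.Icc (0.5 : ℝ) 1, ∃ l ∈ Set.Ioo (0 : ℝ) 1,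
    limSafety DF DW α ≤ τ ∧ L = limLoss DF DW l N α}

/-- The market-entry threshold `N_E*(N_I, τ_I, τ_E)`: the least `N_E ≥ 1` for which the entrant's
performance loss is at most the incumbent's (`⊤` if there is none). -/
noncomputable def entryThreshold (NI : ℕ∞) (τI τE : ℝ) (DW : (P : ℕ) → Measure (Vec P × Vec P))
    (DF : (P : ℕ) → Measure (Vec P)) : ℕ∞ :=
  sInf {N : ℕ∞ | ∃ n : ℕ, N = n ∧ 1 ≤ n ∧ companyLoss DF DW n τE ≤ companyLoss DF DW NI τI}

end Limit

/-- `(√L - √(min(τ, L)))²`. -/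
noncomputable def infLoss (L τ : ℝ) : ℝ :=
  (Real.sqrt L - Real.sqrt (min τ L)) ^ 2

/-- `ν = min(2(1 + γ), δ + γ)`. -/
noncomputable def nu (γ δ : ℝ) : ℝ := min (2 * (1 + γ)) (δ + γ)

/-- `ν' = min(1 + γ, δ + γ)`. -/
noncomputable def nu' (γ δ : ℝ) : ℝ := min (1 + γ) (δ + γ)

end MarketEntry

open MarketEntry

namespace MarketEntry

/-! All matrices in the two losses are functions of Σ, so averaging over the targets turns the
losses into series over eigendirections. Write s = 1 - ρ, e = 1 - α, t_i = κ / (λ_i + κ), w_i = λ_i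
i^(-δ), Z = ∑ w_i, A₁ = ∑ w_i t_i, A₂ = ∑ w_i t_i². The mean safety loss is α² L* with L* = 2 s Z,
so the constraint reads e ≥ e(τ) = 1 - √(min(τ, L*) / L*). The mean performance loss is L* e² plus
an excess which, for e away from 1/2 and d away from 1, is comparable to A₂ + s e (A₁ + d)
(`mixLoss_eq`, `mixLoss_le`, `le_mixLoss`).

With infinite data d = 0 and κ = λ may tend to 0, so the incumbent's loss is L* e(τ_I)² = G_I
(`companyLoss_top`). The entrant pays at least G_E, which leaves it an excess of order D to spend.

Put κ = K^(-1-γ), so that roughly the first K directions are learned. Then t_i ≍ min(1, i/K)^(1+γ),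
hence A₂ ≍ K^(-ν), A₁ ≍ K^(-ν') and d ≍ K/N; logarithms appear only at δ = 2 + γ for A₂ and at δ = 1
for A₁. Every K in [1, cN] is realized by some ridge in (0, 1). So N_E* is, up to constants, the
least N for which some such K satisfies K^(-ν) + X (K^(-ν') + K/N) ≲ D, where X = √(G_E (1 - ρ)) ≍ s
e(τ_E) (`exists_companyLoss_le_of_reaches`, `exists_reaches_of_companyLoss_le`).

If X ≤ D, only the first term matters and N ≍ K ≍ D^(-1/ν). If X ≥ D, then N ≍ X K / D with K the
larger of D^(-1/ν) and (D/X)^(-1/ν'); which of the two is larger separates the second regime from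
the third. -/

/-- The matrix with eigenvectors `v i` and eigenvalues `f i`. -/
noncomputable def spectralMatrix {P : ℕ} (v : OrthonormalBasis (Fin P) ℝ (Vec P)) (f : Fin P → ℝ) :
    Matrix (Fin P) (Fin P) ℝ :=
  (Matrix.of fun i j => (v j).ofLp i) * Matrix.diagonal f * (Matrix.of fun i j => (v i).ofLp j)

/-! ### Functional calculus in an orthonormal eigenbasis -/

section Spectral

variable {P : ℕ} (v : OrthonormalBasis (Fin P) ℝ (Vec P))

lemma basisMatrix_mul_left :
    (Matrix.of fun i j => (v i).ofLp j) * (Matrix.of fun i j => (v j).ofLp i) =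
      (1 : Matrix (Fin P) (Fin P) ℝ) := by
  ext i j
  have h := orthonormal_iff_ite.1 v.orthonormal j i
  rw [PiLp.inner_apply] at h
  simp only [Matrix.mul_apply, Matrix.of_apply, Matrix.one_apply]
  simp only [RCLike.inner_apply, conj_trivial] at h
  rw [h]
  simp [eq_comm]

lemma basisMatrix_mul_right :
    (Matrix.of fun i j => (v j).ofLp i) * (Matrix.of fun i j => (v i).ofLp j) =
      (1 : Matrix (Fin P) (Fin P) ℝ) :=
  mul_eq_one_comm.1 (basisMatrix_mul_left v)

lemma spectralMatrix_mul (f g : Fin P → ℝ) :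
    spectralMatrix v f * spectralMatrix v g = spectralMatrix v (f * g) := by
  have h := basisMatrix_mul_left v
  unfold spectralMatrix
  set U : Matrix (Fin P) (Fin P) ℝ := Matrix.of fun i j => (v j).ofLp i
  set V : Matrix (Fin P) (Fin P) ℝ := Matrix.of fun i j => (v i).ofLp j
  calc U * Matrix.diagonal f * V * (U * Matrix.diagonal g * V)
      = U * Matrix.diagonal f * (V * U) * Matrix.diagonal g * V := by simp only [mul_assoc]
    _ = U * (Matrix.diagonal f * Matrix.diagonal g) * V := by rw [h]; simp only [mul_assoc, one_mul]
    _ = _ := by rw [Matrix.diagonal_mul_diagonal]; rfl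

lemma spectralMatrix_one : spectralMatrix v 1 = 1 := by
  unfold spectralMatrix
  rw [Matrix.diagonal_one', mul_one, basisMatrix_mul_right]

lemma spectralMatrix_pow (f : Fin P → ℝ) (n : ℕ) :
    spectralMatrix v f ^ n = spectralMatrix v (f ^ n) := by
  induction n with
  | zero => simp [spectralMatrix_one]
  | succ n ih => rw [pow_succ, ih, spectralMatrix_mul, pow_succ]

lemma spectralMatrix_add_smul_one (f : Fin P → ℝ) (κ : ℝ) :
    spectralMatrix v f + κ • 1 = spectralMatrix v (fun i => f i + κ) := by
  have h : Matrix.diagonal (fun i => f i + κ) = Matrix.diagonal f + κ • (1 : Matrix (Fin P) _ ℝ) := by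
    rw [Matrix.smul_one_eq_diagonal, Matrix.diagonal_add]
  unfold spectralMatrix
  rw [h, mul_add, add_mul, Matrix.mul_smul, Matrix.smul_mul, mul_one, basisMatrix_mul_right]

lemma spectralMatrix_inv (f : Fin P → ℝ) (hf : ∀ i, f i ≠ 0) :
    (spectralMatrix v f)⁻¹ = spectralMatrix v f⁻¹ := by
  refine Matrix.inv_eq_right_inv ?_
  rw [spectralMatrix_mul, ← spectralMatrix_one v]
  congr 1
  ext i
  simp [hf i]

lemma trace_spectralMatrix (f : Fin P → ℝ) : (spectralMatrix v f).trace = ∑ i, f i := by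
  unfold spectralMatrix
  rw [Matrix.trace_mul_comm, ← mul_assoc, basisMatrix_mul_left, one_mul, Matrix.trace_diagonal]

lemma trace_spectralMatrix_mul_vecMulVec (f : Fin P → ℝ) (a b : Vec P) :
    (spectralMatrix v f * Matrix.vecMulVec a.ofLp b.ofLp).trace =
      ∑ i, f i * (inner ℝ a (v i) * inner ℝ b (v i)) := by
  unfold spectralMatrix
  rw [mul_assoc, mul_assoc, Matrix.trace_mul_comm, mul_assoc, Matrix.trace]
  refine Finset.sum_congr rfl fun i _ => ?_
  rw [Matrix.diag_apply, Matrix.diagonal_mul, Matrix.mul_vecMulVec, Matrix.vecMulVec_mul,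
    Matrix.vecMulVec_apply]
  simp only [PiLp.inner_apply, Matrix.mulVec, Matrix.vecMul, dotProduct, Matrix.of_apply,
    RCLike.inner_apply, conj_trivial]
  congr 2
  exact Finset.sum_congr rfl fun _ _ => mul_comm _ _

lemma eq_spectralMatrix {S : Matrix (Fin P) (Fin P) ℝ} {f : Fin P → ℝ}
    (h : ∀ i, Matrix.toEuclideanLin S (v i) = f i • v i) : S = spectralMatrix v f := by
  have hU : S * (Matrix.of fun i j => (v j).ofLp i) =
      (Matrix.of fun i j => (v j).ofLp i) * Matrix.diagonal f := by
    ext i j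
    have := congrArg (fun x : Vec P => x.ofLp i) (h j)
    simp only [Matrix.toLpLin_apply, PiLp.smul_apply, smul_eq_mul] at this
    rw [Matrix.mul_diagonal, Matrix.mul_apply, Matrix.of_apply, mul_comm, ← this]
    rfl
  unfold spectralMatrix
  rw [← hU, mul_assoc, basisMatrix_mul_right, mul_one]

lemma dotProduct_mulVec_eq_trace (S : Matrix (Fin P) (Fin P) ℝ) (u : Fin P → ℝ) :
    u ⬝ᵥ S.mulVec u = (S * Matrix.vecMulVec u u).trace := by
  rw [Matrix.mul_vecMulVec, Matrix.trace_vecMulVec, dotProduct_comm]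

end Spectral

/-! ### Spectral quantities and averages over the targets -/

/-- The `n`-th eigenvalue of the covariance (counted from `0`). -/
noncomputable def eig (γ : ℝ) (n : ℕ) : ℝ := ((n : ℝ) + 1) ^ (-1 - γ)

/-- The second moment of the coefficient of a target along the `n`-th eigenvector. -/
noncomputable def coef (δ : ℝ) (n : ℕ) : ℝ := ((n : ℝ) + 1) ^ (-δ)

lemma eig_pos (γ : ℝ) (n : ℕ) : 0 < eig γ n := Real.rpow_pos_of_pos (by positivity) _

lemma coef_pos (δ : ℝ) (n : ℕ) : 0 < coef δ n := Real.rpow_pos_of_pos (by positivity) _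

/-- The contribution of the `n`-th eigendirection to the loss of the zero predictor. -/
noncomputable def wt (γ δ : ℝ) (n : ℕ) : ℝ := eig γ n * coef δ n

/-- The fraction of the `n`-th coefficient that is lost by ridge regularization. -/
noncomputable def shrink (γ κ : ℝ) (n : ℕ) : ℝ := κ / (eig γ n + κ)

/-- The fraction of the `n`-th coefficient that is kept by ridge regularization. -/
noncomputable def keep (γ κ : ℝ) (n : ℕ) : ℝ := eig γ n / (eig γ n + κ)

lemma integral_quadratic {γ δ ρ : ℝ} {P : ℕ} {DF : Measure (Vec P)} {DW : Measure (Vec P × Vec P)}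
    {v : OrthonormalBasis (Fin P) ℝ (Vec P)}
    (hv : ∀ i : Fin P,
      Matrix.toEuclideanLin (covMatrix DF) (v i) = ((i : ℝ) + 1) ^ (-1 - γ) • v i ∧
      ∫ b, inner ℝ b.1 (v i) ^ 2 ∂DW = ((i : ℝ) + 1) ^ (-δ) ∧
      ∫ b, inner ℝ b.2 (v i) ^ 2 ∂DW = ((i : ℝ) + 1) ^ (-δ) ∧
      ∫ b, inner ℝ b.1 (v i) * inner ℝ b.2 (v i) ∂DW = ρ * ((i : ℝ) + 1) ^ (-δ))
    (p q z : Fin P → ℝ) :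
    ∫ b, ∑ i, (p i * inner ℝ b.1 (v i) ^ 2 + q i * (inner ℝ b.1 (v i) * inner ℝ b.2 (v i)) +
      z i * inner ℝ b.2 (v i) ^ 2) ∂DW = ∑ i : Fin P, coef δ i * (p i + ρ * q i + z i) := by
  have hpos : ∀ i : Fin P, ((i : ℝ) + 1) ^ (-δ) ≠ 0 := fun i => (coef_pos δ i).ne'
  -- Integrability comes for free: a nonintegrable function would have integral 0, but the
  -- prescribed second moments are nonzero. The cross terms are then products of two L² functions.
  have i1 : ∀ i, Integrable (fun b : Vec P × Vec P => inner ℝ b.1 (v i) ^ 2) DW := fun i =>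
    by_contra fun h => hpos i (by rw [← (hv i).2.1, integral_undef h])
  have i2 : ∀ i, Integrable (fun b : Vec P × Vec P => inner ℝ b.2 (v i) ^ 2) DW := fun i =>
    by_contra fun h => hpos i (by rw [← (hv i).2.2.1, integral_undef h])
  have m1 : ∀ i, AEStronglyMeasurable (fun b : Vec P × Vec P => inner ℝ b.1 (v i)) DW := fun i =>
    (Continuous.inner continuous_fst continuous_const).aestronglyMeasurable
  have m2 : ∀ i, AEStronglyMeasurable (fun b : Vec P × Vec P => inner ℝ b.2 (v i)) DW := fun i =>
    (Continuous.inner continuous_snd continuous_const).aestronglyMeasurable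
  have i12 : ∀ i, Integrable
      (fun b : Vec P × Vec P => inner ℝ b.1 (v i) * inner ℝ b.2 (v i)) DW := fun i =>
    ((memLp_two_iff_integrable_sq (m1 i)).2 (i1 i)).integrable_mul
      ((memLp_two_iff_integrable_sq (m2 i)).2 (i2 i))
  rw [integral_finsetSum]
  · refine Finset.sum_congr rfl fun i _ => ?_
    rw [integral_add, integral_add, integral_const_mul, integral_const_mul, integral_const_mul,
      (hv i).2.1, (hv i).2.2.1, (hv i).2.2.2]
    · unfold coef; ring
    · exact (i1 i).const_mul _
    · exact (i12 i).const_mul _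
    · exact ((i1 i).const_mul _).add ((i12 i).const_mul _)
    · exact (i2 i).const_mul _
  · exact fun i _ => (((i1 i).const_mul _).add ((i12 i).const_mul _)).add ((i2 i).const_mul _)

/-! ### Exact formulas for the mean losses in dimension P -/

section FiniteDimension

variable {γ δ ρ : ℝ} {P : ℕ} {DF : Measure (Vec P)} {DW : Measure (Vec P × Vec P)}

lemma popLoss_eq (h : MemLp (fun x : Vec P => x) 2 DF) (θ β : Vec P) :
    popLoss DF θ β = (θ - β).ofLp ⬝ᵥ (covMatrix DF).mulVec (θ - β).ofLp := by
  have hc : ∀ i, MemLp (fun x : Vec P => x i) 2 DF := fun i =>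
    h.continuousLinearMap_comp (EuclideanSpace.proj i : Vec P →L[ℝ] ℝ)
  have hi : ∀ i j, Integrable (fun x : Vec P => x i * x j) DF := fun i j =>
    (hc i).integrable_mul (hc j)
  have hpt : ∀ x : Vec P, (inner ℝ θ x - inner ℝ β x) ^ 2 =
      ∑ i, ∑ j, (θ - β).ofLp i * (θ - β).ofLp j * (x i * x j) := by
    intro x
    rw [← inner_sub_left, PiLp.inner_apply, sq, Finset.sum_mul_sum]
    refine Finset.sum_congr rfl fun i _ => Finset.sum_congr rfl fun j _ => ?_
    simp only [RCLike.inner_apply, conj_trivial]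
    ring
  unfold popLoss
  simp only [hpt]
  rw [integral_finsetSum _ fun i _ => integrable_finsetSum _ fun j _ => (hi i j).const_mul _]
  simp only [dotProduct, Matrix.mulVec]
  refine Finset.sum_congr rfl fun i _ => ?_
  rw [integral_finsetSum _ fun j _ => (hi i j).const_mul _, Finset.mul_sum]
  refine Finset.sum_congr rfl fun j _ => ?_
  rw [integral_const_mul]
  simp only [covMatrix, Matrix.of_apply]
  ring

lemma sum_fin_eq (f : ℕ → ℝ) : ∑ i : Fin P, f i = ∑ n ∈ Finset.range P, f n :=
  Fin.sum_univ_eq_sum_range f P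

lemma covMatrix_eq {v : OrthonormalBasis (Fin P) ℝ (Vec P)}
    (hv : ∀ i : Fin P, Matrix.toEuclideanLin (covMatrix DF) (v i) = ((i : ℝ) + 1) ^ (-1 - γ) • v i) :
    covMatrix DF = spectralMatrix v fun i => eig γ i :=
  eq_spectralMatrix v hv

lemma popLoss_eq_sum (h : MemLp (fun x : Vec P => x) 2 DF)
    {v : OrthonormalBasis (Fin P) ℝ (Vec P)}
    (hv : ∀ i : Fin P, Matrix.toEuclideanLin (covMatrix DF) (v i) = ((i : ℝ) + 1) ^ (-1 - γ) • v i)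
    (θ β : Vec P) : popLoss DF θ β = ∑ i : Fin P, eig γ i * inner ℝ (θ - β) (v i) ^ 2 := by
  rw [popLoss_eq h, dotProduct_mulVec_eq_trace, covMatrix_eq hv,
    trace_spectralMatrix_mul_vecMulVec]
  simp only [sq]

/-- Completing the square: the objective is the Σ-norm squared of β - m plus a constant, and
positive eigenvalues make the minimizer unique, so the choice made by `Classical.epsilon` is
determined. -/
lemma ridgeless_eq (h : MemLp (fun x : Vec P => x) 2 DF)
    {v : OrthonormalBasis (Fin P) ℝ (Vec P)}
    (hv : ∀ i : Fin P, Matrix.toEuclideanLin (covMatrix DF) (v i) = ((i : ℝ) + 1) ^ (-1 - γ) • v i)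
    (β₁ β₂ : Vec P) (α : ℝ) : ridgeless DF β₁ β₂ α = α • β₁ + (1 - α) • β₂ := by
  set m := α • β₁ + (1 - α) • β₂ with hm
  have key : ∀ β : Vec P, α * popLoss DF β₁ β + (1 - α) * popLoss DF β₂ β =
      ∑ i : Fin P, eig γ i * inner ℝ (β - m) (v i) ^ 2 +
        α * (1 - α) * ∑ i : Fin P, eig γ i * inner ℝ (β₁ - β₂) (v i) ^ 2 := by
    intro β
    rw [popLoss_eq_sum h hv, popLoss_eq_sum h hv, Finset.mul_sum, Finset.mul_sum, Finset.mul_sum,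
      ← Finset.sum_add_distrib, ← Finset.sum_add_distrib]
    refine Finset.sum_congr rfl fun i _ => ?_
    simp only [hm, inner_sub_left, inner_add_left, real_inner_smul_left]
    ring
  have hex : ∃ β : Vec P, ∀ β' : Vec P, α * popLoss DF β₁ β + (1 - α) * popLoss DF β₂ β ≤
      α * popLoss DF β₁ β' + (1 - α) * popLoss DF β₂ β' := by
    refine ⟨m, fun β' => ?_⟩
    rw [key, key]
    have : 0 ≤ ∑ i : Fin P, eig γ i * inner ℝ (β' - m) (v i) ^ 2 :=
      Finset.sum_nonneg fun i _ => mul_nonneg (eig_pos γ i).le (sq_nonneg _)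
    simpa using this
  have hs : α * popLoss DF β₁ (ridgeless DF β₁ β₂ α) +
      (1 - α) * popLoss DF β₂ (ridgeless DF β₁ β₂ α) ≤
      α * popLoss DF β₁ m + (1 - α) * popLoss DF β₂ m := Classical.epsilon_spec hex m
  rw [key, key] at hs
  have hz : ∑ i : Fin P, eig γ i * inner ℝ (ridgeless DF β₁ β₂ α - m) (v i) ^ 2 = 0 := by
    refine le_antisymm (by simpa using hs)
      (Finset.sum_nonneg fun i _ => mul_nonneg (eig_pos γ i).le (sq_nonneg _))
  have hz' := (Finset.sum_eq_zero_iff_of_nonneg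
    fun (i : Fin P) _ => mul_nonneg (eig_pos γ i).le (sq_nonneg _)).1 hz
  rw [← sub_eq_zero]
  refine v.repr.injective ?_
  ext i
  have := hz' i (Finset.mem_univ i)
  rw [v.repr_apply_apply, real_inner_comm]
  simpa [(eig_pos γ i).ne'] using this

lemma meanSafety_eq (h : PowerLaw γ δ ρ DF DW) (α : ℝ) :
    meanSafety DF DW α = α ^ 2 * (2 * (1 - ρ) * ∑ n ∈ Finset.range P, wt γ δ n) := by
  obtain ⟨v, hv⟩ := h.scaling
  have hpt : ∀ b : Vec P × Vec P, safetyLoss DF b.1 b.2 α =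
      ∑ i : Fin P, (α ^ 2 * eig γ i * inner ℝ b.1 (v i) ^ 2 +
        (-2 * α ^ 2 * eig γ i) * (inner ℝ b.1 (v i) * inner ℝ b.2 (v i)) +
        α ^ 2 * eig γ i * inner ℝ b.2 (v i) ^ 2) := by
    intro b
    unfold safetyLoss
    rw [ridgeless_eq h.finite_second_moment fun i => (hv i).1,
      popLoss_eq_sum h.finite_second_moment fun i => (hv i).1]
    refine Finset.sum_congr rfl fun i _ => ?_
    simp only [inner_sub_left, inner_add_left, real_inner_smul_left]
    ring
  unfold meanSafety
  simp only [hpt]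
  rw [integral_quadratic hv, ← sum_fin_eq, Finset.mul_sum, Finset.mul_sum]
  refine Finset.sum_congr rfl fun i _ => ?_
  unfold wt
  ring

lemma meanGap_eq (h : PowerLaw γ δ ρ DF DW) :
    meanGap DF DW = 2 * (1 - ρ) * ∑ n ∈ Finset.range P, wt γ δ n := by
  obtain ⟨v, hv⟩ := h.scaling
  have hpt : ∀ b : Vec P × Vec P, (b.1 - b.2).ofLp ⬝ᵥ (covMatrix DF).mulVec (b.1 - b.2).ofLp =
      ∑ i : Fin P, (eig γ i * inner ℝ b.1 (v i) ^ 2 +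
        (-2 * eig γ i) * (inner ℝ b.1 (v i) * inner ℝ b.2 (v i)) +
        eig γ i * inner ℝ b.2 (v i) ^ 2) := by
    intro b
    rw [← popLoss_eq h.finite_second_moment,
      popLoss_eq_sum h.finite_second_moment fun i => (hv i).1]
    refine Finset.sum_congr rfl fun i _ => ?_
    simp only [inner_sub_left]
    ring
  unfold meanGap
  simp only [hpt]
  rw [integral_quadratic hv, ← sum_fin_eq, Finset.mul_sum]
  refine Finset.sum_congr rfl fun i _ => ?_
  unfold wt
  ring

/-- The mean loss `E[L₁*]` in terms of the spectral sums: `s = 1 - ρ`, `e = 1 - α`, `Z = ∑ w`,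
`A₁ = ∑ w t`, `A₂ = ∑ w t²` for the shrinkage factors `t`, and `d` as in the definition of `L₁*`. -/
noncomputable def mixLoss (s e Z A₁ A₂ d : ℝ) : ℝ :=
  (A₂ + 2 * s * e ^ 2 * (Z - 2 * A₁ + A₂) + 2 * s * e * (A₁ - A₂) +
    2 * s * e * (1 - 2 * e) * d * (Z - A₁)) / (1 - d)

lemma covMatrix_add_inv {v : OrthonormalBasis (Fin P) ℝ (Vec P)}
    (hv : ∀ i : Fin P, Matrix.toEuclideanLin (covMatrix DF) (v i) = ((i : ℝ) + 1) ^ (-1 - γ) • v i)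
    {κ : ℝ} (hκ : 0 ≤ κ) :
    (covMatrix DF + κ • 1)⁻¹ = spectralMatrix v (fun i => (eig γ i + κ)⁻¹) := by
  rw [covMatrix_eq hv, spectralMatrix_add_smul_one, spectralMatrix_inv]
  · rfl
  · exact fun i => (add_pos_of_pos_of_nonneg (eig_pos γ i) hκ).ne'

lemma effReg_eq (h : PowerLaw γ δ ρ DF DW) (l : ℝ) (N : ℕ∞) :
    effReg l N (covMatrix DF) =
      sInf {κ : ℝ | 0 < κ ∧ l / κ + recip N * ∑ n ∈ Finset.range P, keep γ κ n = 1} := by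
  obtain ⟨v, hv⟩ := h.scaling
  unfold effReg
  congr 1
  ext κ
  refine and_congr_right fun hκ => ?_
  rw [covMatrix_add_inv (fun i => (hv i).1) hκ.le, covMatrix_eq fun i => (hv i).1,
    spectralMatrix_mul, trace_spectralMatrix, ← sum_fin_eq]
  rfl

lemma effReg_nonneg (l : ℝ) (N : ℕ∞) (S : Matrix (Fin P) (Fin P) ℝ) : 0 ≤ effReg l N S :=
  Real.sInf_nonneg fun _ h => h.1.le

/-- All five traces are diagonal in the same basis. On average the rank-one matrices A, B, M
contribute 1, 2(1 - ρ), 1 - ρ times i^(-δ) in direction i, and eliminating the kept fraction as 1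
minus the lost one leaves only four sums. -/
lemma meanLoss_eq (h : PowerLaw γ δ ρ DF DW) (l : ℝ) (N : ℕ∞) (α : ℝ) {κ : ℝ}
    (hκ : κ = effReg l N (covMatrix DF)) :
    meanLoss DF DW l N α = mixLoss (1 - ρ) (1 - α) (∑ n ∈ Finset.range P, wt γ δ n)
      (∑ n ∈ Finset.range P, wt γ δ n * shrink γ κ n)
      (∑ n ∈ Finset.range P, wt γ δ n * shrink γ κ n ^ 2)
      (recip N * ∑ n ∈ Finset.range P, keep γ κ n ^ 2) := by
  -- With l arbitrary there may be no root, and the infimum of the empty set is 0; κ ≥ 0 is enough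
  -- because the eigenvalues are positive.
  have hκ0 : 0 ≤ κ := hκ ▸ effReg_nonneg _ _ _
  obtain ⟨v, hv⟩ := h.scaling
  set d := recip N * ∑ n ∈ Finset.range P, keep γ κ n ^ 2 with hd
  have hpt : ∀ b : Vec P × Vec P, detLoss DF b.1 b.2 l N α =
      (∑ i : Fin P, (
        (eig γ i * shrink γ κ i ^ 2 + (1 - α) ^ 2 * eig γ i * keep γ κ i ^ 2 +
          2 * (1 - α) * eig γ i * keep γ κ i * shrink γ κ i
          - 2 * (1 - α) * d * eig γ i * shrink γ κ i +
          (1 - α) * d * eig γ i * (1 - 2 * (1 - α) * keep γ κ i)) * inner ℝ b.1 (v i) ^ 2 +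
        (-2 * ((1 - α) ^ 2 * eig γ i * keep γ κ i ^ 2) -
          2 * (1 - α) * eig γ i * keep γ κ i * shrink γ κ i +
          2 * (1 - α) * d * eig γ i * shrink γ κ i -
          2 * ((1 - α) * d * eig γ i * (1 - 2 * (1 - α) * keep γ κ i))) *
            (inner ℝ b.1 (v i) * inner ℝ b.2 (v i)) +
        ((1 - α) ^ 2 * eig γ i * keep γ κ i ^ 2 +
          (1 - α) * d * eig γ i * (1 - 2 * (1 - α) * keep γ κ i)) * inner ℝ b.2 (v i) ^ 2)) /
        (1 - d) := by
    intro b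
    unfold detLoss
    simp only [← hκ]
    rw [covMatrix_add_inv (fun i => (hv i).1) hκ0, covMatrix_eq fun i => (hv i).1]
    simp only [spectralMatrix_mul, spectralMatrix_pow, trace_spectralMatrix,
      trace_spectralMatrix_mul_vecMulVec]
    have hd' : recip N * ∑ i : Fin P, ((fun i : Fin P => eig γ i) ^ 2 *
        (fun i : Fin P => (eig γ i + κ)⁻¹) ^ 2) i = d := by
      rw [hd, ← sum_fin_eq]
      congr 1
      refine Finset.sum_congr rfl fun i _ => ?_
      simp only [Pi.mul_apply, Pi.pow_apply, keep, div_eq_mul_inv]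
      ring
    rw [hd']
    congr 1
    simp only [Finset.mul_sum, mul_sub, ← Finset.sum_add_distrib, ← Finset.sum_sub_distrib]
    refine Finset.sum_congr rfl fun i _ => ?_
    simp only [Pi.mul_apply, Pi.pow_apply, keep, shrink, div_eq_mul_inv, inner_sub_left]
    ring
  unfold meanLoss
  simp only [hpt]
  rw [integral_div, integral_quadratic hv, mixLoss]
  congr 1
  simp only [← sum_fin_eq, Finset.mul_sum, ← Finset.sum_add_distrib, ← Finset.sum_sub_distrib]
  refine Finset.sum_congr rfl fun i _ => ?_
  have hk : keep γ κ i = 1 - shrink γ κ i := by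
    have := (add_pos_of_pos_of_nonneg (eig_pos γ i) hκ0).ne'
    unfold keep shrink
    field_simp
    ring
  rw [hk]
  unfold wt
  ring

end FiniteDimension

/-! ### The spectral series at P = ∞: summability and termwise bounds -/

lemma recip_nonneg (N : ℕ∞) : 0 ≤ recip N := by
  unfold recip; split_ifs <;> positivity

lemma recip_natCast (n : ℕ) : recip (n : ℕ∞) = 1 / (n : ℝ) := by simp [recip]

lemma recip_top : recip ⊤ = 0 := by simp [recip]

lemma summable_succ_rpow {p : ℝ} (hp : p < -1) : Summable fun n : ℕ => ((n : ℝ) + 1) ^ p := by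
  have := (summable_nat_add_iff 1).2 (Real.summable_nat_rpow.2 hp)
  simpa using this

lemma summable_eig {γ : ℝ} (hγ : 0 < γ) : Summable (eig γ) :=
  summable_succ_rpow (by linarith)

lemma wt_eq (γ δ : ℝ) (n : ℕ) : wt γ δ n = ((n : ℝ) + 1) ^ (-(δ + 1 + γ)) := by
  unfold wt eig coef
  rw [← Real.rpow_add (by positivity)]
  congr 1
  ring

lemma wt_pos (γ δ : ℝ) (n : ℕ) : 0 < wt γ δ n := mul_pos (eig_pos γ n) (coef_pos δ n)

lemma summable_wt {γ δ : ℝ} (hγ : 0 < γ) (hδ : 0 < δ) : Summable (wt γ δ) := by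
  refine (summable_succ_rpow (p := -(δ + 1 + γ)) (by linarith)).congr fun n => ?_
  rw [wt_eq]

lemma shrink_nonneg (γ : ℝ) {κ : ℝ} (hκ : 0 < κ) (n : ℕ) : 0 ≤ shrink γ κ n :=
  div_nonneg hκ.le (add_pos (eig_pos γ n) hκ).le

lemma shrink_le_one (γ : ℝ) {κ : ℝ} (hκ : 0 < κ) (n : ℕ) : shrink γ κ n ≤ 1 := by
  have := eig_pos γ n
  exact (div_le_one (by positivity)).2 (by linarith)

lemma keep_pos (γ : ℝ) {κ : ℝ} (hκ : 0 < κ) (n : ℕ) : 0 < keep γ κ n :=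
  div_pos (eig_pos γ n) (add_pos (eig_pos γ n) hκ)

lemma keep_lt_one (γ : ℝ) {κ : ℝ} (hκ : 0 < κ) (n : ℕ) : keep γ κ n < 1 := by
  have := eig_pos γ n
  exact (div_lt_one (by positivity)).2 (by linarith)

lemma keep_le_div (γ : ℝ) {κ a : ℝ} (ha : 0 < a) (h : a ≤ κ) (n : ℕ) :
    keep γ κ n ≤ eig γ n / a := by
  have := eig_pos γ n
  unfold keep
  gcongr
  linarith

lemma keep_sq_le (γ : ℝ) {κ : ℝ} (hκ : 0 < κ) (n : ℕ) : keep γ κ n ^ 2 ≤ keep γ κ n := by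
  have h0 := keep_pos γ hκ n
  have h1 := keep_lt_one γ hκ n
  nlinarith

lemma keep_antitone (γ : ℝ) {κ κ' : ℝ} (hκ : 0 < κ) (h : κ ≤ κ') (n : ℕ) :
    keep γ κ' n ≤ keep γ κ n := by
  have := eig_pos γ n
  unfold keep
  gcongr

lemma continuousAt_shrink (γ : ℝ) {κ : ℝ} (hκ : 0 < κ) (n : ℕ) :
    ContinuousAt (fun x => shrink γ x n) κ := by
  have := (add_pos (eig_pos γ n) hκ).ne'
  unfold shrink
  fun_prop (disch := assumption)

lemma continuousAt_keep (γ : ℝ) {κ : ℝ} (hκ : 0 < κ) (n : ℕ) :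
    ContinuousAt (fun x => keep γ x n) κ := by
  have := (add_pos (eig_pos γ n) hκ).ne'
  unfold keep
  fun_prop (disch := assumption)

lemma summable_keep {γ : ℝ} (hγ : 0 < γ) {κ : ℝ} (hκ : 0 < κ) : Summable (keep γ κ) :=
  Summable.of_nonneg_of_le (fun n => (keep_pos γ hκ n).le) (fun n => keep_le_div γ hκ le_rfl n)
    ((summable_eig hγ).div_const κ)

lemma summable_keep_sq {γ : ℝ} (hγ : 0 < γ) {κ : ℝ} (hκ : 0 < κ) :
    Summable fun n => keep γ κ n ^ 2 :=
  Summable.of_nonneg_of_le (fun _ => sq_nonneg _) (fun n => keep_sq_le γ hκ n)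
    (summable_keep hγ hκ)

lemma wt_mul_shrink_le (γ δ : ℝ) {κ : ℝ} (hκ : 0 < κ) (n : ℕ) :
    wt γ δ n * shrink γ κ n ≤ wt γ δ n :=
  mul_le_of_le_one_right (wt_pos γ δ n).le (shrink_le_one γ hκ n)

lemma wt_mul_shrink_sq_le (γ δ : ℝ) {κ : ℝ} (hκ : 0 < κ) (n : ℕ) :
    wt γ δ n * shrink γ κ n ^ 2 ≤ wt γ δ n :=
  mul_le_of_le_one_right (wt_pos γ δ n).le
    (pow_le_one₀ (shrink_nonneg γ hκ n) (shrink_le_one γ hκ n))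

lemma summable_wt_mul_shrink {γ δ : ℝ} (hγ : 0 < γ) (hδ : 0 < δ) {κ : ℝ} (hκ : 0 < κ) :
    Summable fun n => wt γ δ n * shrink γ κ n :=
  Summable.of_nonneg_of_le (fun n => mul_nonneg (wt_pos γ δ n).le (shrink_nonneg γ hκ n))
    (wt_mul_shrink_le γ δ hκ) (summable_wt hγ hδ)

lemma summable_wt_mul_shrink_sq {γ δ : ℝ} (hγ : 0 < γ) (hδ : 0 < δ) {κ : ℝ} (hκ : 0 < κ) :
    Summable fun n => wt γ δ n * shrink γ κ n ^ 2 :=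
  Summable.of_nonneg_of_le (fun n => mul_nonneg (wt_pos γ δ n).le (sq_nonneg _))
    (wt_mul_shrink_sq_le γ δ hκ) (summable_wt hγ hδ)

/-- `∑ w`, the loss of the zero predictor. -/
noncomputable def wtSum (γ δ : ℝ) : ℝ := ∑' n, wt γ δ n

/-- `∑ w t` for the shrinkage factors `t`. -/
noncomputable def shrinkSum (γ δ κ : ℝ) : ℝ := ∑' n, wt γ δ n * shrink γ κ n

/-- `∑ w t²` for the shrinkage factors `t`. -/
noncomputable def shrinkSqSum (γ δ κ : ℝ) : ℝ := ∑' n, wt γ δ n * shrink γ κ n ^ 2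

/-- `Tr(Σ Σ_κ⁻¹)` at `P = ∞`. -/
noncomputable def keepSum (γ κ : ℝ) : ℝ := ∑' n, keep γ κ n

/-- `Tr(Σ² Σ_κ⁻²)` at `P = ∞`. -/
noncomputable def keepSqSum (γ κ : ℝ) : ℝ := ∑' n, keep γ κ n ^ 2

lemma keepSum_nonneg (γ : ℝ) {κ : ℝ} (hκ : 0 < κ) : 0 ≤ keepSum γ κ :=
  tsum_nonneg fun n => (keep_pos γ hκ n).le

lemma keepSqSum_le_keepSum {γ : ℝ} (hγ : 0 < γ) {κ : ℝ} (hκ : 0 < κ) :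
    keepSqSum γ κ ≤ keepSum γ κ :=
  (summable_keep_sq hγ hκ).tsum_le_tsum (fun n => keep_sq_le γ hκ n) (summable_keep hγ hκ)

/-! ### Dominated convergence, and the equation of the effective regularizer -/

section DominatedSums

variable {F : ℝ → ℕ → ℝ} {B : ℕ → ℝ} {κ a : ℝ}

/-- Tannery's theorem with two simultaneous limits: the range of summation grows while the parameter
moves to κ. The domination only has to hold on [a, ∞), where the parameter eventually stays. -/
lemma tendsto_sum_range_of_dominated (hB : Summable B) (ha : a < κ)
    (hF : ∀ x, a ≤ x → ∀ n, |F x n| ≤ B n) (hc : ∀ n, ContinuousAt (fun x => F x n) κ)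
    {u : ℕ → ℝ} (hu : Tendsto u atTop (𝓝 κ)) :
    Tendsto (fun P => ∑ n ∈ Finset.range P, F (u P) n) atTop (𝓝 (∑' n, F κ n)) := by
  have hrw : (fun P => ∑ n ∈ Finset.range P, F (u P) n) =
      fun P => ∑' n, (Finset.range P : Set ℕ).indicator (F (u P)) n := by
    funext P
    rw [sum_eq_tsum_indicator]
  rw [hrw]
  have hu' : ∀ᶠ P in atTop, a ≤ u P := (hu.eventually (lt_mem_nhds ha)).mono fun _ h => h.le
  refine tendsto_tsum_of_dominated_convergence hB (fun n => ?_) ?_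
  · refine ((hc n).tendsto.comp hu).congr' ?_
    filter_upwards [eventually_gt_atTop n] with P hP
    rw [Set.indicator_of_mem (by simpa using hP)]
    rfl
  · filter_upwards [hu'] with P hP n
    refine (norm_indicator_le_norm_self _ _).trans ?_
    exact hF _ hP n

lemma continuousAt_tsum_of_dominated (hB : Summable B) (ha : a < κ)
    (hF : ∀ x, a ≤ x → ∀ n, |F x n| ≤ B n) (hc : ∀ n, ContinuousAt (fun x => F x n) κ) :
    ContinuousAt (fun x => ∑' n, F x n) κ := by
  refine tendsto_tsum_of_dominated_convergence hB (fun n => (hc n).tendsto) ?_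
  filter_upwards [lt_mem_nhds ha] with x hx n
  exact hF x hx.le n

end DominatedSums

/-- The left side l/x + g(x) is strictly decreasing, at least 1 at x = l and at most 1 at x = l + A.
-/
lemma exists_unique_root {l A : ℝ} (hl : 0 < l) {g : ℝ → ℝ} (hg0 : ∀ κ, 0 < κ → 0 ≤ g κ)
    (hgA : ∀ κ, 0 < κ → g κ ≤ A / κ) (hanti : ∀ a b, 0 < a → a ≤ b → g b ≤ g a)
    (hcont : ∀ κ, 0 < κ → ContinuousAt g κ) :
    ∃ κ, l ≤ κ ∧ {x : ℝ | 0 < x ∧ l / x + g x = 1} = {κ} := by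
  have hA : 0 ≤ A := by simpa using (hg0 1 one_pos).trans (hgA 1 one_pos)
  have hc : ContinuousOn (fun x => l / x + g x) (Set.Icc l (l + A)) := by
    intro x hx
    have hx0 : 0 < x := hl.trans_le hx.1
    exact ((continuousAt_const.div continuousAt_id hx0.ne').add (hcont x hx0)).continuousWithinAt
  have hend : l / (l + A) + g (l + A) ≤ 1 := by
    have h := hgA (l + A) (by linarith)
    have : l / (l + A) + A / (l + A) = 1 := by
      rw [← add_div, div_self (by linarith)]
    linarith
  have hstart : 1 ≤ l / l + g l := by
    rw [div_self hl.ne']; linarith [hg0 l hl]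
  obtain ⟨κ, hκ, hκ1⟩ := intermediate_value_Icc' (by linarith) hc ⟨hend, hstart⟩
  have hmono : ∀ a b, 0 < a → a < b → l / b + g b < l / a + g a := fun a b ha hab =>
    add_lt_add_of_lt_of_le (div_lt_div_of_pos_left hl ha hab) (hanti a b ha hab.le)
  refine ⟨κ, hκ.1, Set.eq_singleton_iff_unique_mem.2 ⟨⟨hl.trans_le hκ.1, hκ1⟩, ?_⟩⟩
  rintro x ⟨hx0, hx1⟩
  simp only at hκ1
  rcases lt_trichotomy x κ with h | h | h
  · have := hmono x κ hx0 h; linarith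
  · exact h
  · have := hmono κ x (hl.trans_le hκ.1) h; linarith

/-- Since G_P ≤ g, the roots u_P never exceed κ. For a < κ the limit function exceeds 1 at a, hence
so does the P-th one eventually, and its root lies to the right of a. -/
lemma tendsto_root {l : ℝ} (hl : 0 < l) {g : ℝ → ℝ} {G : ℕ → ℝ → ℝ} {κ : ℝ} {u : ℕ → ℝ}
    (hle : ∀ P x, 0 < x → G P x ≤ g x) (hlim : ∀ x, 0 < x → Tendsto (G · x) atTop (𝓝 (g x)))
    (hanti : ∀ a b, 0 < a → a ≤ b → g b ≤ g a)
    (hantiG : ∀ P a b, 0 < a → a ≤ b → G P b ≤ G P a)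
    (hκ : 0 < κ ∧ l / κ + g κ = 1) (hu : ∀ P, 0 < u P ∧ l / u P + G P (u P) = 1) :
    Tendsto u atTop (𝓝 κ) := by
  refine tendsto_order.2 ⟨fun a ha => ?_, fun a ha => Eventually.of_forall fun P => ?_⟩
  · rcases le_or_gt a 0 with h0 | h0
    · exact Eventually.of_forall fun P => h0.trans_lt (hu P).1
    · have h1 : 1 < l / a + g a := by
        rw [← hκ.2]
        exact add_lt_add_of_lt_of_le (div_lt_div_of_pos_left hl h0 ha) (hanti _ _ h0 ha.le)
      filter_upwards [((hlim a h0).const_add (l / a)).eventually (lt_mem_nhds h1)] with P hP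
      by_contra! h
      have h2 := hantiG P _ _ (hu P).1 h
      have h3 : l / a ≤ l / u P := div_le_div_of_nonneg_left hl.le (hu P).1 h
      linarith [(hu P).2]
  · refine lt_of_le_of_lt ?_ ha
    by_contra! h
    have h1 : l / u P < l / κ := div_lt_div_of_pos_left hl hκ.1 h
    have h2 := hantiG P _ _ hκ.1 h.le
    linarith [(hu P).2, hκ.2, hle P κ hκ.1]

/-- The effective regularizer at `P = ∞`. -/
noncomputable def limReg (γ l : ℝ) (N : ℕ∞) : ℝ :=
  sInf {κ : ℝ | 0 < κ ∧ l / κ + recip N * keepSum γ κ = 1}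

lemma effReg_spec {γ δ ρ l : ℝ} (hl : 0 < l) (N : ℕ∞) {P : ℕ} {DF : Measure (Vec P)} {DW : Measure (Vec P × Vec P)}
    (h : PowerLaw γ δ ρ DF DW) : l ≤ effReg l N (covMatrix DF) ∧
      0 < effReg l N (covMatrix DF) ∧ l / effReg l N (covMatrix DF) +
        recip N * ∑ n ∈ Finset.range P, keep γ (effReg l N (covMatrix DF)) n = 1 := by
  obtain ⟨κ, hκ, hs⟩ := exists_unique_root (A := recip N * ∑ n ∈ Finset.range P, eig γ n)
    (g := fun κ => recip N * ∑ n ∈ Finset.range P, keep γ κ n) hl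
    (fun κ hκ => mul_nonneg (recip_nonneg N) (Finset.sum_nonneg fun n _ => (keep_pos γ hκ n).le))
    (fun κ hκ => by
      rw [mul_div_assoc, Finset.sum_div]
      exact mul_le_mul_of_nonneg_left
        (Finset.sum_le_sum fun n _ => keep_le_div γ hκ le_rfl n) (recip_nonneg N))
    (fun a b ha hab => mul_le_mul_of_nonneg_left
      (Finset.sum_le_sum fun n _ => keep_antitone γ ha hab n) (recip_nonneg N))
    (fun κ hκ => continuousAt_const.mul
      (tendsto_finsetSum _ fun n _ => (continuousAt_keep γ hκ n).tendsto))
  have h' : effReg l N (covMatrix DF) = κ := by rw [effReg_eq h, hs, csInf_singleton]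
  rw [h']
  have : κ ∈ {x : ℝ | 0 < x ∧
    l / x + recip N * ∑ n ∈ Finset.range P, keep γ x n = 1} := by rw [hs]; rfl
  exact ⟨hκ, this⟩

section EffectiveRegularizer

variable {γ l : ℝ} (hγ : 0 < γ) (hl : 0 < l) (N : ℕ∞)
include hγ

lemma continuousAt_keepSum {κ : ℝ} (hκ : 0 < κ) : ContinuousAt (keepSum γ) κ := by
  refine continuousAt_tsum_of_dominated (a := κ / 2) (B := fun n => eig γ n / (κ / 2))
    ((summable_eig hγ).div_const _) (by linarith) (fun x hx n => ?_)
    (fun n => continuousAt_keep γ hκ n)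
  rw [abs_of_pos (keep_pos γ (by linarith) n)]
  exact keep_le_div γ (by linarith) hx n

lemma keepSum_antitone {κ κ' : ℝ} (hκ : 0 < κ) (h : κ ≤ κ') : keepSum γ κ' ≤ keepSum γ κ :=
  (summable_keep hγ (hκ.trans_le h)).tsum_le_tsum (fun n => keep_antitone γ hκ h n)
    (summable_keep hγ hκ)

lemma keepSum_le_div {κ : ℝ} (hκ : 0 < κ) : keepSum γ κ ≤ (∑' n, eig γ n) / κ := by
  rw [← tsum_div_const]
  exact (summable_keep hγ hκ).tsum_le_tsum (fun n => keep_le_div γ hκ le_rfl n)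
    ((summable_eig hγ).div_const κ)

include hl

lemma exists_limReg : ∃ κ, l ≤ κ ∧
    {x : ℝ | 0 < x ∧ l / x + recip N * keepSum γ x = 1} = {κ} :=
  exists_unique_root (A := recip N * ∑' n, eig γ n) hl
    (fun κ hκ => mul_nonneg (recip_nonneg N) (keepSum_nonneg γ hκ))
    (fun κ hκ => by
      rw [mul_div_assoc]
      exact mul_le_mul_of_nonneg_left (keepSum_le_div hγ hκ) (recip_nonneg N))
    (fun a b ha hab => mul_le_mul_of_nonneg_left (keepSum_antitone hγ ha hab) (recip_nonneg N))
    (fun κ hκ => continuousAt_const.mul (continuousAt_keepSum hγ hκ))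

lemma limReg_spec : l ≤ limReg γ l N ∧ 0 < limReg γ l N ∧
    l / limReg γ l N + recip N * keepSum γ (limReg γ l N) = 1 := by
  obtain ⟨κ, hκ, hs⟩ := exists_limReg hγ hl N
  have h : limReg γ l N = κ := by unfold limReg; rw [hs, csInf_singleton]
  rw [h]
  have : κ ∈ {x : ℝ | 0 < x ∧ l / x + recip N * keepSum γ x = 1} := by rw [hs]; rfl
  exact ⟨hκ, this⟩

lemma limReg_unique {κ : ℝ} (hκ : 0 < κ) (h : l / κ + recip N * keepSum γ κ = 1) :
    limReg γ l N = κ := by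
  obtain ⟨κ', -, hs⟩ := exists_limReg hγ hl N
  have h1 : κ ∈ {x : ℝ | 0 < x ∧ l / x + recip N * keepSum γ x = 1} := ⟨hκ, h⟩
  rw [hs] at h1
  unfold limReg
  rw [hs, csInf_singleton]
  exact h1.symm

/-- Squares of numbers in (0, 1) are smaller, so 1 - d ≥ l/κ > 0: the denominator of the loss does
not vanish in the limit. -/
lemma limReg_df_lt_one : recip N * keepSqSum γ (limReg γ l N) < 1 := by
  obtain ⟨-, h0, h1⟩ := limReg_spec hγ hl N
  have := mul_le_mul_of_nonneg_left (keepSqSum_le_keepSum hγ h0) (recip_nonneg N)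
  have : 0 < l / limReg γ l N := by positivity
  linarith

end EffectiveRegularizer

/-! ### Passage to the limit P → ∞ -/

section Limits

variable {γ δ ρ : ℝ} {DF : (P : ℕ) → Measure (Vec P)} {DW : (P : ℕ) → Measure (Vec P × Vec P)}
  (hγ : 0 < γ) (hδ : 0 < δ) (h : ∀ P : ℕ, PowerLaw γ δ ρ (DF P) (DW P))
include hγ h

lemma tendsto_effReg {l : ℝ} (hl : 0 < l) (N : ℕ∞) :
    Tendsto (fun P : ℕ => effReg l N (covMatrix (DF P))) atTop (𝓝 (limReg γ l N)) := by
  refine tendsto_root (g := fun κ => recip N * keepSum γ κ)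
    (G := fun P κ => recip N * ∑ n ∈ Finset.range P, keep γ κ n) hl ?_ ?_ ?_ ?_
    (limReg_spec hγ hl N).2 (fun P => (effReg_spec hl N (h P)).2)
  · exact fun P x hx => mul_le_mul_of_nonneg_left ((summable_keep hγ hx).sum_le_tsum _
      fun n _ => (keep_pos γ hx n).le) (recip_nonneg N)
  · exact fun x hx => (summable_keep hγ hx).hasSum.tendsto_sum_nat.const_mul _
  · exact fun a b ha hab =>
      mul_le_mul_of_nonneg_left (keepSum_antitone hγ ha hab) (recip_nonneg N)
  · exact fun P a b ha hab => mul_le_mul_of_nonneg_left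
      (Finset.sum_le_sum fun n _ => keep_antitone γ ha hab n) (recip_nonneg N)

include hδ

lemma tendsto_meanLoss {l : ℝ} (hl : 0 < l) (N : ℕ∞) (α : ℝ) :
    Tendsto (fun P : ℕ => meanLoss (DF P) (DW P) l N α) atTop
      (𝓝 (mixLoss (1 - ρ) (1 - α) (wtSum γ δ) (shrinkSum γ δ (limReg γ l N))
        (shrinkSqSum γ δ (limReg γ l N)) (recip N * keepSqSum γ (limReg γ l N)))) := by
  have hu := tendsto_effReg hγ h hl N
  obtain ⟨hl1, hκ, -⟩ := limReg_spec hγ hl N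
  set κ := limReg γ l N with hκdef
  -- As κ ≥ l, the ray [l/2, ∞) contains a neighbourhood of κ; all three dominations are uniform on
  -- it.
  have ha : l / 2 < κ := by linarith
  have hpos : ∀ x, l / 2 ≤ x → 0 < x := fun x hx => by linarith
  have hZ := (summable_wt hγ hδ).hasSum.tendsto_sum_nat
  have h1 := tendsto_sum_range_of_dominated (F := fun x n => wt γ δ n * shrink γ x n)
    (summable_wt hγ hδ) ha (fun x hx n => by
      rw [abs_of_nonneg (mul_nonneg (wt_pos γ δ n).le (shrink_nonneg γ (hpos x hx) n))]
      exact wt_mul_shrink_le γ δ (hpos x hx) n)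
    (fun n => continuousAt_const.mul (continuousAt_shrink γ hκ n)) hu
  have h2 := tendsto_sum_range_of_dominated (F := fun x n => wt γ δ n * shrink γ x n ^ 2)
    (summable_wt hγ hδ) ha (fun x hx n => by
      rw [abs_of_nonneg (mul_nonneg (wt_pos γ δ n).le (sq_nonneg _))]
      exact wt_mul_shrink_sq_le γ δ (hpos x hx) n)
    (fun n => continuousAt_const.mul ((continuousAt_shrink γ hκ n).pow 2)) hu
  have h3 := tendsto_sum_range_of_dominated (F := fun x n => keep γ x n ^ 2)
    (B := fun n => eig γ n / (l / 2)) ((summable_eig hγ).div_const _) ha (fun x hx n => by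
      rw [abs_of_nonneg (sq_nonneg _)]
      exact (keep_sq_le γ (hpos x hx) n).trans (keep_le_div γ (by linarith) hx n))
    (fun n => (continuousAt_keep γ hκ n).pow 2) hu
  have hd := h3.const_mul (recip N)
  have hlt : recip N * keepSqSum γ κ < 1 := limReg_df_lt_one hγ hl N
  have hmain : Tendsto (fun P : ℕ => mixLoss (1 - ρ) (1 - α)
      (∑ n ∈ Finset.range P, wt γ δ n)
      (∑ n ∈ Finset.range P, wt γ δ n * shrink γ (effReg l N (covMatrix (DF P))) n)
      (∑ n ∈ Finset.range P, wt γ δ n * shrink γ (effReg l N (covMatrix (DF P))) n ^ 2)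
      (recip N * ∑ n ∈ Finset.range P, keep γ (effReg l N (covMatrix (DF P))) n ^ 2)) atTop
      (𝓝 (mixLoss (1 - ρ) (1 - α) (wtSum γ δ) (shrinkSum γ δ κ)
        (shrinkSqSum γ δ κ) (recip N * keepSqSum γ κ))) := by
    unfold mixLoss
    refine Tendsto.div ?_ (hd.const_sub 1) (by
      change 1 - recip N * keepSqSum γ κ ≠ 0
      linarith)
    refine ((h2.add (((hZ.sub (h1.const_mul 2)).add h2).const_mul _)).add
      ((h1.sub h2).const_mul _)).add ?_
    exact (hd.const_mul _).mul (hZ.sub h1)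
  exact hmain.congr fun P => (meanLoss_eq (h P) l N α rfl).symm

lemma limLoss_eq {l : ℝ} (hl : 0 < l) (N : ℕ∞) (α : ℝ) :
    limLoss DF DW l N α = mixLoss (1 - ρ) (1 - α) (wtSum γ δ) (shrinkSum γ δ (limReg γ l N))
        (shrinkSqSum γ δ (limReg γ l N)) (recip N * keepSqSum γ (limReg γ l N)) :=
  (tendsto_meanLoss hγ hδ h hl N α).limUnder_eq

lemma tendsto_meanSafety (α : ℝ) :
    Tendsto (fun P : ℕ => meanSafety (DF P) (DW P) α) atTop
      (𝓝 (α ^ 2 * (2 * (1 - ρ) * wtSum γ δ))) :=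
  (((summable_wt hγ hδ).hasSum.tendsto_sum_nat.const_mul _).const_mul _).congr
    fun P => (meanSafety_eq (h P) α).symm

lemma limSafety_eq (α : ℝ) : limSafety DF DW α = α ^ 2 * (2 * (1 - ρ) * wtSum γ δ) :=
  (tendsto_meanSafety hγ hδ h α).limUnder_eq

lemma tendsto_meanGap :
    Tendsto (fun P : ℕ => meanGap (DF P) (DW P)) atTop (𝓝 (2 * (1 - ρ) * wtSum γ δ)) :=
  ((summable_wt hγ hδ).hasSum.tendsto_sum_nat.const_mul _).congr
    fun P => (meanGap_eq (h P)).symm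

lemma limGap_eq : limGap DF DW = 2 * (1 - ρ) * wtSum γ δ :=
  (tendsto_meanGap hγ hδ h).limUnder_eq

end Limits

/-! ### Two-sided bounds for capped power sums -/

section PowerSums

/-- Bernoulli's inequality if b ≤ 1; if b ≥ 1, a number in [0, 1] only decreases when raised to the
power b. Telescoping this increment replaces the comparison of power sums with integrals. -/
lemma sub_one_rpow_le {b x : ℝ} (hb : 0 < b) (hx : 1 ≤ x) :
    (x - 1) ^ b ≤ x ^ b - min 1 b * x ^ (b - 1) := by
  have hx0 : 0 < x := by linarith
  have hu0 : 0 ≤ 1 - 1 / x := by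
    have : 1 / x ≤ 1 := (div_le_one hx0).2 hx
    linarith
  have hu1 : 1 - 1 / x ≤ 1 := by
    have : 0 < 1 / x := by positivity
    linarith
  have hkey : (1 - 1 / x) ^ b ≤ 1 - min 1 b / x := by
    rcases le_total b 1 with h | h
    · rw [min_eq_right h]
      have := rpow_one_add_le_one_add_mul_self (s := -(1 / x)) (by linarith) hb.le h
      calc (1 - 1 / x) ^ b = (1 + -(1 / x)) ^ b := by ring_nf
        _ ≤ 1 + b * -(1 / x) := this
        _ = 1 - b / x := by ring
    · rw [min_eq_left h]
      rcases hu0.eq_or_lt with h0 | h0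
      · rw [← h0, Real.zero_rpow hb.ne']
      · simpa using Real.rpow_le_rpow_of_exponent_ge h0 hu1 h
  calc (x - 1) ^ b = (x * (1 - 1 / x)) ^ b := by congr 1; field_simp
    _ = x ^ b * (1 - 1 / x) ^ b := Real.mul_rpow hx0.le hu0
    _ ≤ x ^ b * (1 - min 1 b / x) := by gcongr
    _ = x ^ b - min 1 b * x ^ (b - 1) := by rw [Real.rpow_sub_one hx0.ne']; ring

lemma sum_range_rpow_le {b : ℝ} (hb : 0 < b) (M : ℕ) :
    min 1 b * ∑ n ∈ Finset.range M, ((n : ℝ) + 1) ^ (b - 1) ≤ (M : ℝ) ^ b := by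
  induction M with
  | zero => simp [Real.zero_rpow hb.ne']
  | succ M ih =>
    have h := sub_one_rpow_le hb (x := (M : ℝ) + 1) (by linarith [(Nat.cast_nonneg M : (0 : ℝ) ≤ M)])
    rw [add_sub_cancel_right] at h
    rw [Finset.sum_range_succ, mul_add]
    push_cast
    linarith

lemma rpow_neg_step {a x : ℝ} (ha : 0 < a) (hx : 1 < x) :
    min 1 a * x ^ (-(a + 1)) ≤ (x - 1) ^ (-a) - x ^ (-a) := by
  have hx0 : 0 < x := by linarith
  have hm : 0 < min 1 a := lt_min one_pos ha
  have h := sub_one_rpow_le ha hx.le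
  have hV : 0 < (x - 1) ^ a := Real.rpow_pos_of_pos (by linarith) _
  have hY : 0 < x ^ a := Real.rpow_pos_of_pos hx0 _
  rw [Real.rpow_sub_one hx0.ne'] at h
  rw [Real.rpow_neg (by linarith : 0 ≤ x - 1), Real.rpow_neg hx0.le, Real.rpow_neg hx0.le,
    Real.rpow_add_one hx0.ne']
  have hVY : (x - 1) ^ a ≤ x ^ a := Real.rpow_le_rpow (by linarith) (by linarith) ha.le
  rw [inv_sub_inv hV.ne' hY.ne', le_div_iff₀ (mul_pos hV hY)]
  calc min 1 a * (x ^ a * x)⁻¹ * ((x - 1) ^ a * x ^ a)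
      = min 1 a / x * (x - 1) ^ a := by field_simp
    _ ≤ min 1 a / x * x ^ a := by gcongr
    _ = min 1 a * (x ^ a / x) := by ring
    _ ≤ x ^ a - (x - 1) ^ a := by linarith

lemma tsum_tail_rpow_le {a : ℝ} (ha : 0 < a) {m : ℕ} (hm : 1 ≤ m) :
    min 1 a * ∑' n : ℕ, (((n + m : ℕ) : ℝ) + 1) ^ (-(a + 1)) ≤ (m : ℝ) ^ (-a) := by
  have hpart : ∀ M : ℕ, min 1 a * ∑ n ∈ Finset.range M, (((n + m : ℕ) : ℝ) + 1) ^ (-(a + 1)) ≤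
      (m : ℝ) ^ (-a) - ((M + m : ℕ) : ℝ) ^ (-a) := by
    intro M
    induction M with
    | zero => simp
    | succ M ih =>
      have h1 : (1 : ℝ) ≤ m := by exact_mod_cast hm
      have h := rpow_neg_step ha (x := ((M + m : ℕ) : ℝ) + 1)
        (by push_cast; linarith [(Nat.cast_nonneg M : (0 : ℝ) ≤ M)])
      rw [add_sub_cancel_right] at h
      rw [Finset.sum_range_succ, mul_add]
      have h2 : ((M + 1 + m : ℕ) : ℝ) = ((M + m : ℕ) : ℝ) + 1 := by push_cast; ring
      rw [h2]
      linarith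
  have hc : 0 < min 1 a := lt_min one_pos ha
  rw [mul_comm, ← le_div_iff₀ hc]
  refine Real.tsum_le_of_sum_range_le (fun n => by positivity) fun M => ?_
  rw [le_div_iff₀ hc, mul_comm]
  refine (hpart M).trans (sub_le_self _ (by positivity))

/-- `∑ i^(-p) min(1, i / K)^q` over `i ≥ 1`. -/
noncomputable def capSum (p q K : ℝ) : ℝ :=
  ∑' n : ℕ, ((n : ℝ) + 1) ^ (-p) * min 1 (((n : ℝ) + 1) / K) ^ q

variable {p q : ℝ}

lemma cap_nonneg {K : ℝ} (hK : 1 ≤ K) (n : ℕ) : 0 ≤ min 1 (((n : ℝ) + 1) / K) :=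
  le_min zero_le_one (by positivity)

lemma capSum_term_nonneg (p q : ℝ) {K : ℝ} (hK : 1 ≤ K) (n : ℕ) :
    0 ≤ ((n : ℝ) + 1) ^ (-p) * min 1 (((n : ℝ) + 1) / K) ^ q :=
  mul_nonneg (by positivity) (Real.rpow_nonneg (cap_nonneg hK n) _)

lemma capSum_term_le (p : ℝ) (hq : 0 < q) {K : ℝ} (hK : 1 ≤ K) (n : ℕ) :
    ((n : ℝ) + 1) ^ (-p) * min 1 (((n : ℝ) + 1) / K) ^ q ≤ ((n : ℝ) + 1) ^ (-p) :=
  mul_le_of_le_one_right (by positivity)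
    (Real.rpow_le_one (cap_nonneg hK n) (min_le_left _ _) hq.le)

lemma capSum_term_le' (p : ℝ) (hq : 0 < q) {K : ℝ} (hK : 1 ≤ K) (n : ℕ) :
    ((n : ℝ) + 1) ^ (-p) * min 1 (((n : ℝ) + 1) / K) ^ q ≤
      K ^ (-q) * ((n : ℝ) + 1) ^ (q - p) := by
  have hK0 : 0 < K := by linarith
  calc ((n : ℝ) + 1) ^ (-p) * min 1 (((n : ℝ) + 1) / K) ^ q
      ≤ ((n : ℝ) + 1) ^ (-p) * (((n : ℝ) + 1) / K) ^ q := by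
        gcongr
        exact min_le_right _ _
    _ = K ^ (-q) * (((n : ℝ) + 1) ^ q * ((n : ℝ) + 1) ^ (-p)) := by
        rw [Real.div_rpow (by positivity) hK0.le, Real.rpow_neg hK0.le q]
        ring
    _ = K ^ (-q) * ((n : ℝ) + 1) ^ (q - p) := by
        rw [← Real.rpow_add (by positivity), sub_eq_add_neg]

lemma summable_capSum (hp : 1 < p) (hq : 0 < q) {K : ℝ} (hK : 1 ≤ K) :
    Summable fun n : ℕ => ((n : ℝ) + 1) ^ (-p) * min 1 (((n : ℝ) + 1) / K) ^ q :=
  Summable.of_nonneg_of_le (capSum_term_nonneg p q hK) (capSum_term_le p hq hK)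
    (summable_succ_rpow (by linarith))

/-- If q < p - 1, the series of i^(q-p) converges and K^(-q) factors out. If q > p - 1, the sum is
split at ⌊K⌋: the head is of order K^(-q) K^(q-p+1) and the tail of order K^(1-p). At q = p - 1 a
logarithm would appear. -/
lemma exists_capSum_le (hp : 1 < p) (hq : 0 < q) (hne : q ≠ p - 1) :
    ∃ C : ℝ, 0 < C ∧ ∀ K : ℝ, 1 ≤ K → capSum p q K ≤ C * K ^ (-min q (p - 1)) := by
  rcases lt_or_gt_of_ne hne with h | h
  · have hs : Summable fun n : ℕ => ((n : ℝ) + 1) ^ (q - p) := summable_succ_rpow (by linarith)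
    refine ⟨∑' n : ℕ, ((n : ℝ) + 1) ^ (q - p),
      hs.tsum_pos (fun n => by positivity) 0 (by positivity), fun K hK => ?_⟩
    rw [min_eq_left h.le, mul_comm, ← tsum_mul_left]
    exact (summable_capSum hp hq hK).tsum_le_tsum (capSum_term_le' p hq hK) (hs.mul_left _)
  · have hb : 0 < q - p + 1 := by linarith
    have ha : 0 < p - 1 := by linarith
    have hmb : 0 < min 1 (q - p + 1) := lt_min one_pos hb
    have hma : 0 < min 1 (p - 1) := lt_min one_pos ha
    refine ⟨1 / min 1 (q - p + 1) + 2 ^ (p - 1) / min 1 (p - 1), by positivity, fun K hK => ?_⟩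
    have hK0 : 0 < K := by linarith
    rw [min_eq_right h.le]
    set m := ⌊K⌋₊ with hm
    have hm1 : 1 ≤ m := Nat.le_floor (by simpa using hK)
    have hm1' : (1 : ℝ) ≤ m := by exact_mod_cast hm1
    have hmK : (m : ℝ) ≤ K := Nat.floor_le hK0.le
    have hKm : K ≤ 2 * m := by
      have := Nat.lt_floor_add_one K
      rw [← hm] at this
      linarith
    unfold capSum
    rw [← (summable_capSum hp hq hK).sum_add_tsum_nat_add m, add_mul]
    refine add_le_add ?_ ?_
    · calc _ ≤ ∑ n ∈ Finset.range m, K ^ (-q) * ((n : ℝ) + 1) ^ (q - p) :=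
            Finset.sum_le_sum fun n _ => capSum_term_le' p hq hK n
        _ = K ^ (-q) * ∑ n ∈ Finset.range m, ((n : ℝ) + 1) ^ (q - p) := by rw [Finset.mul_sum]
        _ ≤ K ^ (-q) * (1 / min 1 (q - p + 1) * K ^ (q - p + 1)) := by
            gcongr
            rw [one_div, inv_mul_eq_div, le_div_iff₀ hmb, mul_comm]
            have := sum_range_rpow_le hb m
            rw [add_sub_cancel_right] at this
            exact this.trans (Real.rpow_le_rpow (by positivity) hmK hb.le)
        _ = 1 / min 1 (q - p + 1) * K ^ (-(p - 1)) := by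
            rw [mul_left_comm, ← Real.rpow_add hK0]
            congr 2
            ring
    · have hs : Summable fun n : ℕ => (((n + m : ℕ) : ℝ) + 1) ^ (-p) :=
        (summable_nat_add_iff (f := fun n : ℕ => ((n : ℝ) + 1) ^ (-p)) m).2
          (summable_succ_rpow (by linarith))
      calc _ ≤ ∑' n : ℕ, (((n + m : ℕ) : ℝ) + 1) ^ (-p) :=
            ((summable_nat_add_iff m).2 (summable_capSum hp hq hK)).tsum_le_tsum
              (fun n => capSum_term_le p hq hK (n + m)) hs
        _ ≤ (m : ℝ) ^ (-(p - 1)) / min 1 (p - 1) := by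
            rw [le_div_iff₀ hma, mul_comm]
            simpa using tsum_tail_rpow_le ha hm1
        _ ≤ (K / 2) ^ (-(p - 1)) / min 1 (p - 1) := by
            gcongr ?_ / _
            exact Real.rpow_le_rpow_of_nonpos (by positivity) (by linarith) (by linarith)
        _ = _ := by
            rw [Real.div_rpow hK0.le (by norm_num), Real.rpow_neg (by norm_num : (0 : ℝ) ≤ 2)]
            field_simp

/-- One part of the sum suffices: the first term if the minimum is q, otherwise the block of about K
indices between ⌈K⌉ and 2⌈K⌉, where the cap equals 1. A logarithm would only help, so q = p - 1 is
allowed. -/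
lemma exists_le_capSum (hp : 1 < p) (hq : 0 < q) :
    ∃ c : ℝ, 0 < c ∧ ∀ K : ℝ, 1 ≤ K → c * K ^ (-min q (p - 1)) ≤ capSum p q K := by
  refine ⟨2 ^ (-p) * 2 ^ (-(p - 1)), by positivity, fun K hK => ?_⟩
  have hK0 : 0 < K := by linarith
  rcases min_choice q (p - 1) with h | h
  · rw [h]
    have hc : (2 : ℝ) ^ (-p) * 2 ^ (-(p - 1)) ≤ 1 :=
      mul_le_one₀ (Real.rpow_le_one_of_one_le_of_nonpos (by norm_num) (by linarith))
        (by positivity) (Real.rpow_le_one_of_one_le_of_nonpos (by norm_num) (by linarith))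
    have h0 := (summable_capSum hp hq hK).le_tsum 0 fun n _ => capSum_term_nonneg p q hK n
    have h1 : min 1 (1 / K) = 1 / K := min_eq_right ((div_le_one hK0).2 hK)
    have h2 : (1 / K) ^ q = K ^ (-q) := by rw [one_div, Real.inv_rpow hK0.le, Real.rpow_neg hK0.le]
    simp only [CharP.cast_eq_zero, zero_add, Real.one_rpow, one_mul, h1, h2] at h0
    exact (mul_le_of_le_one_left (by positivity) hc).trans h0
  · rw [h]
    set m := ⌈K⌉₊ with hm
    have hmK : K ≤ m := Nat.le_ceil K
    have hm0 : (0 : ℝ) < m := by linarith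
    have hm2 : (m : ℝ) ≤ 2 * K := by
      have := Nat.ceil_lt_add_one hK0.le
      rw [← hm] at this
      linarith
    have h0 := (summable_capSum hp hq hK).sum_le_tsum (Finset.Ico m (2 * m))
      fun n _ => capSum_term_nonneg p q hK n
    have h1 : ∑ n ∈ Finset.Ico m (2 * m), (2 * (m : ℝ)) ^ (-p) ≤
        ∑ n ∈ Finset.Ico m (2 * m), ((n : ℝ) + 1) ^ (-p) * min 1 (((n : ℝ) + 1) / K) ^ q := by
      refine Finset.sum_le_sum fun n hn => ?_
      rw [Finset.mem_Ico] at hn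
      have hn1 : (m : ℝ) ≤ n := by exact_mod_cast hn.1
      have hn2 : (n : ℝ) + 1 ≤ 2 * m := by exact_mod_cast hn.2
      rw [min_eq_left ((one_le_div hK0).2 (by linarith)), Real.one_rpow, mul_one]
      exact Real.rpow_le_rpow_of_nonpos (by positivity) hn2 (by linarith)
    rw [Finset.sum_const, Nat.card_Ico, nsmul_eq_mul] at h1
    have h2 : ((2 * m - m : ℕ) : ℝ) = m := by congr 1; omega
    rw [h2] at h1
    refine le_trans ?_ (h1.trans h0)
    calc (2 : ℝ) ^ (-p) * 2 ^ (-(p - 1)) * K ^ (-(p - 1))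
        = 2 ^ (-p) * (2 * K) ^ (-(p - 1)) := by rw [Real.mul_rpow (by norm_num) hK0.le]; ring
      _ ≤ 2 ^ (-p) * (m : ℝ) ^ (-(p - 1)) := by
          gcongr ?_ * ?_
          exact Real.rpow_le_rpow_of_nonpos hm0 hm2 (by linarith)
      _ = m * (2 * (m : ℝ)) ^ (-p) := by
          rw [Real.mul_rpow (by norm_num) hm0.le, show -(p - 1) = -p + 1 by ring,
            Real.rpow_add_one hm0.ne']
          ring

end PowerSums

/-! ### Power-law rates of the spectral sums in terms of the cutoff K -/

section SpectralSums

variable {γ δ K : ℝ}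

/-- The regularizer for which the spectrum is cut off at the index `K`. -/
noncomputable def cutReg (γ K : ℝ) : ℝ := K ^ (-(1 + γ))

lemma cutReg_pos (γ : ℝ) (hK : 1 ≤ K) : 0 < cutReg γ K :=
  Real.rpow_pos_of_pos (by linarith) _

lemma cutReg_div_eig (hK : 1 ≤ K) (n : ℕ) :
    cutReg γ K = eig γ n * (((n : ℝ) + 1) / K) ^ (1 + γ) := by
  have hK0 : 0 < K := by linarith
  unfold cutReg eig
  rw [Real.div_rpow (by positivity) hK0.le, show -1 - γ = -(1 + γ) by ring,
    Real.rpow_neg (by positivity), Real.rpow_neg (by positivity)]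
  have : (0 : ℝ) < ((n : ℝ) + 1) ^ (1 + γ) := by positivity
  field_simp

lemma shrink_cutReg (hK : 1 ≤ K) (n : ℕ) : shrink γ (cutReg γ K) n =
    (((n : ℝ) + 1) / K) ^ (1 + γ) / (1 + (((n : ℝ) + 1) / K) ^ (1 + γ)) := by
  have hK0 : 0 < K := by linarith
  unfold shrink
  rw [cutReg_div_eig hK n]
  have := eig_pos γ n
  have : (0 : ℝ) < (((n : ℝ) + 1) / K) ^ (1 + γ) := by positivity
  field_simp

lemma keep_cutReg (hK : 1 ≤ K) (n : ℕ) : keep γ (cutReg γ K) n =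
    1 / (1 + (((n : ℝ) + 1) / K) ^ (1 + γ)) := by
  have hK0 : 0 < K := by linarith
  unfold keep
  rw [cutReg_div_eig hK n]
  have := eig_pos γ n
  have : (0 : ℝ) < (((n : ℝ) + 1) / K) ^ (1 + γ) := by positivity
  field_simp

lemma min_one_rpow {u q : ℝ} (hu : 0 ≤ u) (hq : 0 < q) : min 1 u ^ q = min 1 (u ^ q) := by
  rcases le_total 1 u with h | h
  · rw [min_eq_left h, min_eq_left (Real.one_le_rpow h hq.le), Real.one_rpow]
  · rw [min_eq_right h, min_eq_right (Real.rpow_le_one hu h hq.le)]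

/-- The lost fraction is v / (1 + v) with v = (i/K)^(1+γ), and this lies between min(1, v)/2 and
min(1, v); so the spectral sums are comparable to values of `capSum`. -/
lemma shrink_cutReg_le (hγ : 0 < γ) (hK : 1 ≤ K) (n : ℕ) :
    shrink γ (cutReg γ K) n ≤ min 1 (((n : ℝ) + 1) / K) ^ (1 + γ) := by
  have hK0 : 0 < K := by linarith
  have hu : 0 < ((n : ℝ) + 1) / K := by positivity
  rw [shrink_cutReg hK, min_one_rpow hu.le (by linarith)]
  have hv : 0 < (((n : ℝ) + 1) / K) ^ (1 + γ) := by positivity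
  refine le_min ((div_le_one (by positivity)).2 (by linarith)) ?_
  exact div_le_self hv.le (by linarith)

lemma le_shrink_cutReg (hγ : 0 < γ) (hK : 1 ≤ K) (n : ℕ) :
    1 / 2 * min 1 (((n : ℝ) + 1) / K) ^ (1 + γ) ≤ shrink γ (cutReg γ K) n := by
  have hK0 : 0 < K := by linarith
  have hu : 0 < ((n : ℝ) + 1) / K := by positivity
  rw [shrink_cutReg hK, min_one_rpow hu.le (by linarith)]
  have hv : 0 < (((n : ℝ) + 1) / K) ^ (1 + γ) := by positivity
  rw [le_div_iff₀ (by positivity)]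
  rcases le_total 1 ((((n : ℝ) + 1) / K) ^ (1 + γ)) with h | h
  · rw [min_eq_left h]; linarith
  · rw [min_eq_right h]; nlinarith

lemma cap_rpow_sq (γ : ℝ) (hK : 1 ≤ K) (n : ℕ) :
    (min 1 (((n : ℝ) + 1) / K) ^ (1 + γ)) ^ 2 = min 1 (((n : ℝ) + 1) / K) ^ (2 * (1 + γ)) := by
  rw [mul_comm 2, Real.rpow_mul (cap_nonneg hK n), Real.rpow_two]

lemma nu_eq (γ δ : ℝ) : nu γ δ = min (2 * (1 + γ)) (δ + 1 + γ - 1) := by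
  unfold nu; congr 1; ring

lemma nu'_eq (γ δ : ℝ) : nu' γ δ = min (1 + γ) (δ + 1 + γ - 1) := by
  unfold nu'; congr 1; ring

variable (hγ : 0 < γ) (hδ : 0 < δ)
include hγ hδ

lemma exists_shrinkSqSum_le (hcrit : δ ≠ 2 + γ) : ∃ C : ℝ, 0 < C ∧ ∀ K : ℝ, 1 ≤ K →
    shrinkSqSum γ δ (cutReg γ K) ≤ C * K ^ (-nu γ δ) := by
  obtain ⟨C, hC, h⟩ := exists_capSum_le (p := δ + 1 + γ) (q := 2 * (1 + γ)) (by linarith)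
    (by linarith) (fun h => hcrit (by linarith))
  refine ⟨C, hC, fun K hK => ?_⟩
  rw [nu_eq]
  refine le_trans ?_ (h K hK)
  refine (summable_wt_mul_shrink_sq hγ hδ (cutReg_pos γ hK)).tsum_le_tsum (fun n => ?_)
    (summable_capSum (by linarith) (by linarith) hK)
  rw [← wt_eq, ← cap_rpow_sq γ hK]
  have := wt_pos γ δ n
  gcongr
  · exact shrink_nonneg γ (cutReg_pos γ hK) n
  · exact shrink_cutReg_le hγ hK n

lemma exists_le_shrinkSqSum : ∃ c : ℝ, 0 < c ∧ ∀ K : ℝ, 1 ≤ K →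
    c * K ^ (-nu γ δ) ≤ shrinkSqSum γ δ (cutReg γ K) := by
  obtain ⟨c, hc, h⟩ := exists_le_capSum (p := δ + 1 + γ) (q := 2 * (1 + γ)) (by linarith)
    (by linarith)
  refine ⟨1 / 4 * c, by positivity, fun K hK => ?_⟩
  rw [nu_eq, mul_assoc]
  refine (mul_le_mul_of_nonneg_left (h K hK) (by norm_num)).trans ?_
  unfold capSum
  rw [← tsum_mul_left]
  refine ((summable_capSum (by linarith) (by linarith) hK).mul_left _).tsum_le_tsum (fun n => ?_)
    (summable_wt_mul_shrink_sq hγ hδ (cutReg_pos γ hK))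
  rw [← wt_eq, ← cap_rpow_sq γ hK]
  have h1 := wt_pos γ δ n
  have h2 : (1 / 2 * min 1 (((n : ℝ) + 1) / K) ^ (1 + γ)) ^ 2 ≤ shrink γ (cutReg γ K) n ^ 2 :=
    pow_le_pow_left₀ (mul_nonneg (by norm_num) (Real.rpow_nonneg (cap_nonneg hK n) _))
      (le_shrink_cutReg hγ hK n) 2
  calc _ = wt γ δ n * (1 / 2 * min 1 (((n : ℝ) + 1) / K) ^ (1 + γ)) ^ 2 := by ring
    _ ≤ _ := by gcongr

lemma shrinkSum_le_capSum {q : ℝ} (hq : 0 < q) (hq1 : q ≤ 1 + γ) (hK : 1 ≤ K) :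
    shrinkSum γ δ (cutReg γ K) ≤ capSum (δ + 1 + γ) q K := by
  refine (summable_wt_mul_shrink hγ hδ (cutReg_pos γ hK)).tsum_le_tsum (fun n => ?_)
    (summable_capSum (by linarith) hq hK)
  rw [← wt_eq]
  have hK0 : 0 < K := by linarith
  refine mul_le_mul_of_nonneg_left ((shrink_cutReg_le hγ hK n).trans ?_) (wt_pos γ δ n).le
  exact Real.rpow_le_rpow_of_exponent_ge (lt_min one_pos (by positivity)) (min_le_left _ _) hq1

/-- At δ = 1 the rate K^(-ν') fails by a logarithm, so a weaker power is accepted there. This is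
harmless: only the first regime includes δ = 1, and there any positive exponent will do. -/
lemma exists_shrinkSum_le : ∃ μ : ℝ, 0 < μ ∧ (δ ≠ 1 → μ = nu' γ δ) ∧ ∃ C : ℝ, 0 < C ∧
    ∀ K : ℝ, 1 ≤ K → shrinkSum γ δ (cutReg γ K) ≤ C * K ^ (-μ) := by
  by_cases h1 : δ = 1
  · refine ⟨γ / 2, by linarith, fun h => absurd h1 h, ?_⟩
    obtain ⟨C, hC, h⟩ := exists_capSum_le (p := δ + 1 + γ) (q := γ / 2) (by linarith)
      (by linarith) (by linarith)
    rw [min_eq_left (by linarith)] at h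
    exact ⟨C, hC, fun K hK =>
      (shrinkSum_le_capSum hγ hδ (by linarith) (by linarith) hK).trans (h K hK)⟩
  · refine ⟨nu' γ δ, lt_min (by linarith) (by linarith), fun _ => rfl, ?_⟩
    obtain ⟨C, hC, h⟩ := exists_capSum_le (p := δ + 1 + γ) (q := 1 + γ) (by linarith)
      (by linarith) (fun h => h1 (by linarith))
    rw [← nu'_eq] at h
    exact ⟨C, hC, fun K hK =>
      (shrinkSum_le_capSum hγ hδ (by linarith) le_rfl hK).trans (h K hK)⟩

lemma exists_le_shrinkSum : ∃ c : ℝ, 0 < c ∧ ∀ K : ℝ, 1 ≤ K →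
    c * K ^ (-nu' γ δ) ≤ shrinkSum γ δ (cutReg γ K) := by
  obtain ⟨c, hc, h⟩ := exists_le_capSum (p := δ + 1 + γ) (q := 1 + γ) (by linarith)
    (by linarith)
  refine ⟨1 / 2 * c, by positivity, fun K hK => ?_⟩
  rw [nu'_eq, mul_assoc]
  refine (mul_le_mul_of_nonneg_left (h K hK) (by norm_num)).trans ?_
  unfold capSum
  rw [← tsum_mul_left]
  refine ((summable_capSum (by linarith) (by linarith) hK).mul_left _).tsum_le_tsum (fun n => ?_)
    (summable_wt_mul_shrink hγ hδ (cutReg_pos γ hK))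
  rw [← wt_eq, mul_left_comm]
  exact mul_le_mul_of_nonneg_left (le_shrink_cutReg hγ hK n) (wt_pos γ δ n).le

omit hδ

/-- The kept fraction is at most min(1, v)/v with v = (i/K)^(1+γ), so the sum is at most K^(1+γ)
times a capped sum of order K^(-γ). -/
lemma exists_keepSum_le : ∃ C : ℝ, 0 < C ∧ ∀ K : ℝ, 1 ≤ K →
    keepSum γ (cutReg γ K) ≤ C * K := by
  obtain ⟨C, hC, h⟩ := exists_capSum_le (p := 1 + γ) (q := 1 + γ) (by linarith)
    (by linarith) (by linarith)
  refine ⟨C, hC, fun K hK => ?_⟩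
  have hK0 : 0 < K := by linarith
  have hle : keepSum γ (cutReg γ K) ≤ K ^ (1 + γ) * capSum (1 + γ) (1 + γ) K := by
    unfold capSum
    rw [← tsum_mul_left]
    refine (summable_keep hγ (cutReg_pos γ hK)).tsum_le_tsum (fun n => ?_)
      ((summable_capSum (by linarith) (by linarith) hK).mul_left _)
    have hu : 0 < ((n : ℝ) + 1) / K := by positivity
    have hv : 0 < (((n : ℝ) + 1) / K) ^ (1 + γ) := by positivity
    have heq : K ^ (1 + γ) * ((n : ℝ) + 1) ^ (-(1 + γ)) = 1 / (((n : ℝ) + 1) / K) ^ (1 + γ) := by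
      rw [Real.div_rpow (by positivity) hK0.le, Real.rpow_neg (by positivity), one_div_div,
        div_eq_mul_inv]
    rw [keep_cutReg hK, ← mul_assoc, heq, min_one_rpow hu.le (by linarith),
      div_mul_eq_mul_div, one_mul, div_le_div_iff₀ (by positivity) hv, one_mul]
    rcases le_total 1 ((((n : ℝ) + 1) / K) ^ (1 + γ)) with h | h
    · rw [min_eq_left h]; linarith
    · rw [min_eq_right h]; nlinarith
  refine hle.trans ((mul_le_mul_of_nonneg_left (h K hK) (by positivity)).trans (le_of_eq ?_))
  rw [min_eq_right (by linarith), mul_left_comm, ← Real.rpow_add hK0]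
  congr 1
  ring_nf
  exact Real.rpow_one K

/-- Each index up to ⌊K⌋ ≥ K/2 keeps at least half of its coefficient, so contributes at least 1/4.
-/
lemma le_keepSqSum (hK : 1 ≤ K) : K / 8 ≤ keepSqSum γ (cutReg γ K) := by
  have hK0 : 0 < K := by linarith
  have h0 := (summable_keep_sq hγ (cutReg_pos γ hK)).sum_le_tsum (Finset.range ⌊K⌋₊)
    fun n _ => sq_nonneg _
  have h1 : ∑ n ∈ Finset.range ⌊K⌋₊, (1 / 4 : ℝ) ≤
      ∑ n ∈ Finset.range ⌊K⌋₊, keep γ (cutReg γ K) n ^ 2 := by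
    refine Finset.sum_le_sum fun n hn => ?_
    have hn1 : (n : ℝ) + 1 ≤ K := by
      have : n + 1 ≤ ⌊K⌋₊ := Finset.mem_range.1 hn
      exact (by exact_mod_cast this : (n : ℝ) + 1 ≤ ⌊K⌋₊).trans (Nat.floor_le hK0.le)
    have hv0 : (0 : ℝ) ≤ (((n : ℝ) + 1) / K) ^ (1 + γ) := by positivity
    have hv : (((n : ℝ) + 1) / K) ^ (1 + γ) ≤ 1 :=
      Real.rpow_le_one (by positivity) ((div_le_one hK0).2 hn1) (by linarith)
    have : 1 / 2 ≤ keep γ (cutReg γ K) n := by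
      rw [keep_cutReg hK]
      exact one_div_le_one_div_of_le (by positivity) (by linarith)
    nlinarith
  rw [Finset.sum_const, Finset.card_range, nsmul_eq_mul] at h1
  have h2 : K ≤ 2 * ⌊K⌋₊ := by
    have h3 := Nat.lt_floor_add_one K
    have h4 : (1 : ℝ) ≤ ⌊K⌋₊ := by exact_mod_cast Nat.le_floor (by simpa using hK)
    linarith
  exact le_trans (by linarith) (h1.trans h0)

end SpectralSums

/-! ### The scalar optimization over the cutoff and the dataset size -/

/-- The excess loss with `n` data points and spectral cutoff `K`, up to constants; `X` measures the
size of the mixing penalty of the entrant. -/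
noncomputable def tradeoff (ν μ X K n : ℝ) : ℝ := K ^ (-ν) + X * (K ^ (-μ) + K / n)

/-- `n` data points reach the excess loss `D` by a spectral cutoff `K ≤ c₁ n`. -/
def Reaches (ν μ c₁ C₀ X D : ℝ) (n : ℕ) : Prop :=
  1 ≤ n ∧ ∃ K : ℝ, 1 ≤ K ∧ K ≤ c₁ * n ∧ C₀ * tradeoff ν μ X K n ≤ D

section Optimization

variable {ν ν' μ c₁ C₀ X D : ℝ}

/-- The number of data points per unit of cutoff that suffices if `X ≤ D`. -/
noncomputable def sizeFactor (c₁ C₀ : ℝ) : ℝ := max 1 (max (1 / c₁) (3 * C₀))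

lemma one_le_sizeFactor (c₁ C₀ : ℝ) : 1 ≤ sizeFactor c₁ C₀ := le_max_left _ _

/-- Each of the three terms of the trade-off gets a budget of D/3. The first two fit by assumption;
for the third take n = ⌈B K R⌉ with B the size factor: B ≥ 3 C₀ and R ≥ X/D make it fit, B ≥ 1/c₁
gives K ≤ c₁ n, and the factor 2 absorbs the rounding. -/
lemma exists_reaches (hc₁ : 0 < c₁) (hC₀ : 0 < C₀) (hD : 0 < D) {K R : ℝ} (hK : 1 ≤ K)
    (h1 : C₀ * K ^ (-ν) ≤ D / 3) (h2 : C₀ * (X * K ^ (-μ)) ≤ D / 3) (hR : 1 ≤ R) (hXR : X ≤ R * D) :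
    ∃ n : ℕ, Reaches ν μ c₁ C₀ X D n ∧ (n : ℝ) ≤ 2 * sizeFactor c₁ C₀ * K * R := by
  set B := sizeFactor c₁ C₀ with hB
  have hB1 : 1 ≤ B := one_le_sizeFactor _ _
  have hB2 : 1 / c₁ ≤ B := (le_max_left _ _).trans (le_max_right _ _)
  have hB3 : 3 * C₀ ≤ B := (le_max_right _ _).trans (le_max_right _ _)
  have hBK : 1 ≤ B * K := one_le_mul_of_one_le_of_one_le hB1 hK
  have hT : 1 ≤ B * K * R := one_le_mul_of_one_le_of_one_le hBK hR
  have hn : B * K * R ≤ (⌈B * K * R⌉₊ : ℝ) := Nat.le_ceil _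
  have hn' : (⌈B * K * R⌉₊ : ℝ) < B * K * R + 1 := Nat.ceil_lt_add_one (by linarith)
  have hn0 : (0 : ℝ) < (⌈B * K * R⌉₊ : ℝ) := by linarith
  refine ⟨⌈B * K * R⌉₊, ⟨by exact_mod_cast hn0, K, hK, ?_, ?_⟩, by linarith⟩
  · have h3 : 1 ≤ c₁ * B := by
      rw [div_le_iff₀ hc₁] at hB2; linarith
    calc K ≤ c₁ * B * K * R := by
          have : K ≤ (c₁ * B) * K := le_mul_of_one_le_left (by linarith) h3
          exact this.trans (le_mul_of_one_le_right (by linarith) hR)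
      _ = c₁ * (B * K * R) := by ring
      _ ≤ _ := by gcongr
  · have h3 : C₀ * (X * (K / (⌈B * K * R⌉₊ : ℝ))) ≤ D / 3 := by
      rw [← mul_div_assoc, ← mul_div_assoc, div_le_iff₀ hn0]
      calc C₀ * (X * K) ≤ C₀ * (R * D * K) := by gcongr
        _ = 3 * C₀ * (K * R * D / 3) := by ring
        _ ≤ B * (K * R * D / 3) := by gcongr
        _ = D / 3 * (B * K * R) := by ring
        _ ≤ _ := by gcongr
    unfold tradeoff
    linarith

lemma eventually_mul_rpow_neg_le (hν : 0 < ν) (C : ℝ) {ε : ℝ} (hε : 0 < ε) :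
    ∀ᶠ A : ℝ in atTop, C * A ^ (-ν) ≤ ε := by
  have := (tendsto_rpow_neg_atTop hν).const_mul C
  rw [mul_zero] at this
  exact (this.eventually (gt_mem_nhds hε)).mono fun _ h => h.le

/-- Without a rate, this gives finiteness of the threshold for every D > 0, including δ = 1 outside
the first regime. -/
lemma exists_reaches_of_pos (hν : 0 < ν) (hμ : 0 < μ) (hc₁ : 0 < c₁) (hC₀ : 0 < C₀)
    (hD : 0 < D) : ∃ n : ℕ, Reaches ν μ c₁ C₀ X D n := by
  obtain ⟨K, ⟨h1, h2⟩, hK⟩ := (((eventually_mul_rpow_neg_le hν C₀ (by positivity : 0 < D / 3)).and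
    (eventually_mul_rpow_neg_le hμ (C₀ * X) (by positivity : 0 < D / 3))).and
    (eventually_ge_atTop 1)).exists
  obtain ⟨n, hn, -⟩ := exists_reaches hc₁ hC₀ hD hK h1 (by rwa [← mul_assoc])
    (le_max_left 1 (X / D)) (by rw [← div_le_iff₀ hD]; exact le_max_right _ _)
  exact ⟨n, hn⟩

lemma mul_rpow_neg_inv_rpow_neg {A D a b : ℝ} (hA : 0 < A) (hD : 0 < D) :
    (A * D ^ (-(1 / a))) ^ (-b) = A ^ (-b) * D ^ (b / a) := by
  rw [Real.mul_rpow hA.le (by positivity), ← Real.rpow_mul hD.le]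
  congr 2
  ring

lemma one_le_mul_rpow_neg {A D M a : ℝ} (ha : 0 < a) (hD : 0 < D) (hDM : D ≤ M)
    (hA : M ^ (1 / a) ≤ A) : 1 ≤ A * D ^ (-(1 / a)) := by
  have h1 : D ^ (1 / a) ≤ A := (Real.rpow_le_rpow hD.le hDM (by positivity)).trans hA
  have h2 : 0 < D ^ (1 / a) := by positivity
  rw [Real.rpow_neg hD.le, ← div_eq_mul_inv]
  exact (one_le_div h2).2 h1

/-- The cutoff K = A D^(-1/ν) brings the bias below D/3; as X ≤ D and K^(-μ) is small, the penalty
follows, and n of order K suffices. -/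
lemma reaches_of_penalty_le (hν : 0 < ν) (hμ : 0 < μ) (hc₁ : 0 < c₁) (hC₀ : 0 < C₀) (M : ℝ) :
    ∃ C : ℝ, 0 < C ∧ ∀ X D : ℝ, 0 ≤ X → 0 < D → D ≤ M → X ≤ D →
      ∃ n : ℕ, Reaches ν μ c₁ C₀ X D n ∧ (n : ℝ) ≤ C * D ^ (-(1 / ν)) := by
  -- A is large enough that bias and penalty each take at most a third of D, and that K ≥ 1 for
  -- every D ≤ M.
  obtain ⟨A, ⟨⟨h1, h2⟩, hA⟩, hA0⟩ := (((((eventually_mul_rpow_neg_le hν C₀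
      (by norm_num : (0 : ℝ) < 1 / 3))).and
    (eventually_mul_rpow_neg_le hμ (C₀ * M ^ (μ / ν)) (by norm_num : (0 : ℝ) < 1 / 3))).and
    (eventually_ge_atTop (M ^ (1 / ν)))).and (eventually_gt_atTop 0)).exists
  have hB := one_le_sizeFactor c₁ C₀
  refine ⟨2 * sizeFactor c₁ C₀ * A, by positivity, fun X D hX hD hDM hXD => ?_⟩
  have hbias : C₀ * (A * D ^ (-(1 / ν))) ^ (-ν) ≤ D / 3 := by
    rw [mul_rpow_neg_inv_rpow_neg hA0 hD, div_self hν.ne', Real.rpow_one, ← mul_assoc]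
    nlinarith
  have hpen : C₀ * (X * (A * D ^ (-(1 / ν))) ^ (-μ)) ≤ D / 3 := by
    rw [mul_rpow_neg_inv_rpow_neg hA0 hD]
    calc C₀ * (X * (A ^ (-μ) * D ^ (μ / ν))) ≤ C₀ * (D * (A ^ (-μ) * M ^ (μ / ν))) := by
          gcongr
      _ = C₀ * M ^ (μ / ν) * A ^ (-μ) * D := by ring
      _ ≤ 1 / 3 * D := by gcongr
      _ = D / 3 := by ring
  obtain ⟨n, hn, hle⟩ := exists_reaches (ν := ν) (μ := μ) (R := 1) hc₁ hC₀ hD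
    (one_le_mul_rpow_neg hν hD hDM hA) hbias hpen le_rfl (by linarith)
  exact ⟨n, hn, hle.trans (le_of_eq (by ring))⟩

/-- The same cutoff K = A D^(-1/ν), but now the term X K / n dictates n ≍ X K / D. The last
hypothesis says that the penalty X K^(-ν') at this cutoff is still of order D. -/
lemma reaches_of_le_penalty (hν : 0 < ν) (hν' : 0 < ν') (hc₁ : 0 < c₁) (hC₀ : 0 < C₀) (M : ℝ) :
    ∃ C : ℝ, 0 < C ∧ ∀ X D : ℝ, 0 < D → D ≤ M → D ≤ X →
      X * D ^ (ν' / ν) ≤ M * D →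
      ∃ n : ℕ, Reaches ν ν' c₁ C₀ X D n ∧ (n : ℝ) ≤ C * (D ^ (-((ν + 1) / ν)) * X) := by
  obtain ⟨A, ⟨⟨h1, h2⟩, hA⟩, hA0⟩ := (((((eventually_mul_rpow_neg_le hν C₀
      (by norm_num : (0 : ℝ) < 1 / 3))).and
    (eventually_mul_rpow_neg_le hν' (C₀ * M) (by norm_num : (0 : ℝ) < 1 / 3))).and
    (eventually_ge_atTop (M ^ (1 / ν)))).and (eventually_gt_atTop 0)).exists
  have hB := one_le_sizeFactor c₁ C₀
  refine ⟨2 * sizeFactor c₁ C₀ * A, by positivity, fun X D hD hDM hDX hXD => ?_⟩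
  have hbias : C₀ * (A * D ^ (-(1 / ν))) ^ (-ν) ≤ D / 3 := by
    rw [mul_rpow_neg_inv_rpow_neg hA0 hD, div_self hν.ne', Real.rpow_one, ← mul_assoc]
    nlinarith
  have hpen : C₀ * (X * (A * D ^ (-(1 / ν))) ^ (-ν')) ≤ D / 3 := by
    rw [mul_rpow_neg_inv_rpow_neg hA0 hD]
    calc C₀ * (X * (A ^ (-ν') * D ^ (ν' / ν))) = C₀ * A ^ (-ν') * (X * D ^ (ν' / ν)) := by ring
      _ ≤ C₀ * A ^ (-ν') * (M * D) := by gcongr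
      _ = C₀ * M * A ^ (-ν') * D := by ring
      _ ≤ 1 / 3 * D := by gcongr
      _ = D / 3 := by ring
  obtain ⟨n, hn, hle⟩ := exists_reaches (ν := ν) (μ := ν') (R := X / D) hc₁ hC₀ hD
    (one_le_mul_rpow_neg hν hD hDM hA) hbias hpen ((one_le_div hD).2 hDX)
    (div_mul_cancel₀ X hD.ne').ge
  refine ⟨n, hn, hle.trans (le_of_eq ?_)⟩
  have : D ^ (-((ν + 1) / ν)) = D ^ (-(1 / ν)) / D := by
    rw [← Real.rpow_sub_one hD.ne']
    congr 1
    field_simp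
    ring
  rw [this]
  ring

/-- Here the penalty dictates the cutoff K = A (D/X)^(-1/ν'). The bias is then of order
(D/X)^(ν/ν'), and this is at most D exactly because D ≤ X^(ν/(ν-ν')). -/
lemma reaches_of_le_penalty_rpow (hν' : 0 < ν') (hνν' : ν' < ν) (hc₁ : 0 < c₁) (hC₀ : 0 < C₀)
    {M : ℝ} (hM : 0 < M) : ∃ C : ℝ, 0 < C ∧ ∀ X D : ℝ, 0 < X → X ≤ M → 0 < D →
      D ≤ X ^ (ν / (ν - ν')) →
      ∃ n : ℕ, Reaches ν ν' c₁ C₀ X D n ∧ (n : ℝ) ≤ C * (D / X) ^ (-((ν' + 1) / ν')) := by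
  have hν : 0 < ν := hν'.trans hνν'
  have hsub : 0 < ν - ν' := by linarith
  -- An upper bound for D/X in this regime, as D/X ≤ X^(ν'/(ν-ν')).
  set Y₀ := M ^ (ν' / (ν - ν')) with hY₀
  have hY₀0 : 0 < Y₀ := by positivity
  obtain ⟨A, ⟨⟨h1, h2⟩, hA⟩, hA0⟩ := (((((eventually_mul_rpow_neg_le hν C₀
      (by norm_num : (0 : ℝ) < 1 / 3))).and
    (eventually_mul_rpow_neg_le hν' C₀ (by norm_num : (0 : ℝ) < 1 / 3))).and
    (eventually_ge_atTop (Y₀ ^ (1 / ν')))).and (eventually_gt_atTop 0)).exists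
  have hB := one_le_sizeFactor c₁ C₀
  have hm : 0 < max 1 Y₀ := lt_max_of_lt_left one_pos
  refine ⟨2 * sizeFactor c₁ C₀ * A * max 1 Y₀, by positivity, fun X D hX hXM hD hDX => ?_⟩
  have hY : 0 < D / X := by positivity
  have hYY₀ : D / X ≤ Y₀ := by
    have h3 : X ^ (ν / (ν - ν')) / X = X ^ (ν' / (ν - ν')) := by
      rw [← Real.rpow_sub_one hX.ne']
      congr 1
      field_simp
      ring
    calc D / X ≤ X ^ (ν / (ν - ν')) / X := by gcongr
      _ = X ^ (ν' / (ν - ν')) := h3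
      _ ≤ Y₀ := Real.rpow_le_rpow hX.le hXM (by positivity)
  have hbias : C₀ * (A * (D / X) ^ (-(1 / ν'))) ^ (-ν) ≤ D / 3 := by
    rw [mul_rpow_neg_inv_rpow_neg hA0 hY, ← mul_assoc]
    have h4 : (D / X) ^ (ν / ν') ≤ D := by
      rw [Real.div_rpow hD.le hX.le, div_le_iff₀ (by positivity)]
      have h5 : D ^ ((ν - ν') / ν') ≤ X ^ (ν / ν') := by
        refine (Real.rpow_le_rpow hD.le hDX (by positivity)).trans (le_of_eq ?_)
        rw [← Real.rpow_mul hX.le]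
        congr 1
        field_simp
      calc D ^ (ν / ν') = D * D ^ ((ν - ν') / ν') := by
            rw [← Real.rpow_one_add' hD.le (by positivity)]
            congr 1
            field_simp
            ring
        _ ≤ D * X ^ (ν / ν') := by gcongr
    calc C₀ * A ^ (-ν) * (D / X) ^ (ν / ν') ≤ 1 / 3 * D := by gcongr
      _ = D / 3 := by ring
  have hpen : C₀ * (X * (A * (D / X) ^ (-(1 / ν'))) ^ (-ν')) ≤ D / 3 := by
    rw [mul_rpow_neg_inv_rpow_neg hA0 hY, div_self hν'.ne', Real.rpow_one]
    calc C₀ * (X * (A ^ (-ν') * (D / X))) = C₀ * A ^ (-ν') * D := by field_simp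
      _ ≤ 1 / 3 * D := by gcongr
      _ = D / 3 := by ring
  have hratio : X ≤ max 1 Y₀ / (D / X) * D := by
    rw [div_div_eq_mul_div, div_mul_cancel₀ _ hD.ne']
    exact le_mul_of_one_le_left hX.le (le_max_left _ _)
  -- D may exceed X by a bounded factor, so X/D is enlarged by max 1 Y₀ to make R ≥ 1.
  obtain ⟨n, hn, hle⟩ := exists_reaches (ν := ν) (μ := ν') (R := max 1 Y₀ / (D / X)) hc₁ hC₀ hD
    (one_le_mul_rpow_neg hν' hY hYY₀ hA) hbias hpen
    ((one_le_div hY).2 (hYY₀.trans (le_max_right _ _))) hratio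
  refine ⟨n, hn, hle.trans (le_of_eq ?_)⟩
  have : (D / X) ^ (-((ν' + 1) / ν')) = (D / X) ^ (-(1 / ν')) / (D / X) := by
    rw [← Real.rpow_sub_one hY.ne']
    congr 1
    field_simp
    ring
  rw [this]
  ring

lemma rpow_neg_inv_le {K y a c : ℝ} (ha : 0 < a) (hK : 0 < K) (hc : 0 < c) (hy : 0 < y)
    (h : c * K ^ (-a) ≤ y) : c ^ (1 / a) * y ^ (-(1 / a)) ≤ K := by
  have h1 : K ^ (-a) ≤ y / c := by rw [le_div_iff₀ hc]; linarith
  have h2 : (y / c) ^ (-(1 / a)) ≤ (K ^ (-a)) ^ (-(1 / a)) :=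
    Real.rpow_le_rpow_of_nonpos (by positivity) h1 (by simp [ha.le])
  rw [← Real.rpow_mul hK.le, show -a * -(1 / a) = 1 by field_simp, Real.rpow_one] at h2
  refine le_trans (le_of_eq ?_) h2
  rw [Real.div_rpow hy.le hc.le, Real.rpow_neg hc.le (1 / a)]
  field_simp

/-! ### Lower bounds on the dataset size -/

section Necessary

variable {c₀ C₁ : ℝ} {n : ℕ} (h : Reaches ν ν' C₁ c₀ X D n)
include h

/-- The bias alone forces K ≳ D^(-1/ν), and n ≥ K / C₁. -/
lemma Reaches.rpow_le (hν : 0 < ν) (hc₀ : 0 < c₀) (hC₁ : 0 < C₁) (hX : 0 ≤ X) (hD : 0 < D) :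
    c₀ ^ (1 / ν) / C₁ * D ^ (-(1 / ν)) ≤ n := by
  obtain ⟨-, K, hK, hKn, hle⟩ := h
  have hK0 : 0 < K := by linarith
  have h1 : c₀ * K ^ (-ν) ≤ D := by
    refine le_trans (mul_le_mul_of_nonneg_left ?_ hc₀.le) hle
    unfold tradeoff
    exact le_add_of_nonneg_right (by positivity)
  have h2 := (rpow_neg_inv_le hν hK0 hc₀ hD h1).trans hKn
  rw [div_mul_eq_mul_div, div_le_iff₀ hC₁]
  linarith

/-- The bias forces K ≳ D^(-1/ν); the term X K / n then forces n ≳ X K / D. -/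
lemma Reaches.penalty_rpow_le (hν : 0 < ν) (hc₀ : 0 < c₀) (hX : 0 ≤ X) (hD : 0 < D) :
    c₀ * c₀ ^ (1 / ν) * (D ^ (-((ν + 1) / ν)) * X) ≤ n := by
  obtain ⟨hn, K, hK, hKn, hle⟩ := h
  have hK0 : 0 < K := by linarith
  have hn0 : (0 : ℝ) < n := by exact_mod_cast hn
  have h1 : c₀ * K ^ (-ν) ≤ D := by
    refine le_trans (mul_le_mul_of_nonneg_left ?_ hc₀.le) hle
    unfold tradeoff
    exact le_add_of_nonneg_right (by positivity)
  have h2 := rpow_neg_inv_le hν hK0 hc₀ hD h1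
  have h3 : c₀ * (X * (K / n)) ≤ D := by
    refine le_trans (mul_le_mul_of_nonneg_left ?_ hc₀.le) hle
    unfold tradeoff
    rw [mul_add, ← add_assoc]
    exact le_add_of_nonneg_left (by positivity)
  have h4 : c₀ * (X * K) / D ≤ n := by
    rw [← mul_div_assoc, ← mul_div_assoc, div_le_iff₀ hn0] at h3
    rw [div_le_iff₀ hD]
    linarith
  have h5 : D ^ (-((ν + 1) / ν)) = D ^ (-(1 / ν)) / D := by
    rw [← Real.rpow_sub_one hD.ne']
    congr 1
    field_simp
    ring
  refine le_trans ?_ h4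
  rw [h5]
  calc c₀ * c₀ ^ (1 / ν) * (D ^ (-(1 / ν)) / D * X)
      = c₀ * (X * (c₀ ^ (1 / ν) * D ^ (-(1 / ν)))) / D := by ring
    _ ≤ _ := by gcongr

/-- The penalty X K^(-ν') forces K ≳ (D/X)^(-1/ν'); again n ≳ X K / D. -/
lemma Reaches.ratio_rpow_le (hν' : 0 < ν') (hc₀ : 0 < c₀) (hX : 0 < X) (hD : 0 < D) :
    c₀ * c₀ ^ (1 / ν') * (D / X) ^ (-((ν' + 1) / ν')) ≤ n := by
  obtain ⟨hn, K, hK, hKn, hle⟩ := h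
  have hK0 : 0 < K := by linarith
  have hY : 0 < D / X := by positivity
  have hn0 : (0 : ℝ) < n := by exact_mod_cast hn
  have h1 : c₀ * K ^ (-ν') ≤ D / X := by
    rw [le_div_iff₀ hX, mul_assoc, mul_comm _ X]
    refine le_trans (mul_le_mul_of_nonneg_left ?_ hc₀.le) hle
    unfold tradeoff
    rw [mul_add, add_left_comm]
    exact le_add_of_nonneg_right (by positivity)
  have h2 := rpow_neg_inv_le hν' hK0 hc₀ hY h1
  have h3 : c₀ * (X * (K / n)) ≤ D := by
    refine le_trans (mul_le_mul_of_nonneg_left ?_ hc₀.le) hle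
    unfold tradeoff
    rw [mul_add, ← add_assoc]
    exact le_add_of_nonneg_left (by positivity)
  have h4 : c₀ * K / (D / X) ≤ n := by
    rw [← mul_div_assoc, ← mul_div_assoc, div_le_iff₀ hn0] at h3
    rw [div_div_eq_mul_div, div_le_iff₀ hD]
    linarith
  have h5 : (D / X) ^ (-((ν' + 1) / ν')) = (D / X) ^ (-(1 / ν')) / (D / X) := by
    rw [← Real.rpow_sub_one hY.ne']
    congr 1
    field_simp
    ring
  refine le_trans ?_ h4
  rw [h5]
  calc c₀ * c₀ ^ (1 / ν') * ((D / X) ^ (-(1 / ν')) / (D / X))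
      = c₀ * (c₀ ^ (1 / ν') * (D / X) ^ (-(1 / ν'))) / (D / X) := by ring
    _ ≤ _ := by gcongr

end Necessary

end Optimization

/-! ### The loss as irreducible mixing loss plus trade-off -/

section LossBounds

/-- Splits off 2 s e² Z, the value at A₁ = A₂ = d = 0, which no amount of data removes; the rest is
the excess. -/
lemma mixLoss_eq {s e Z A₁ A₂ d : ℝ} (hd : d < 1) :
    mixLoss s e Z A₁ A₂ d = 2 * s * e ^ 2 * Z + ((1 - 2 * s * e * (1 - e)) * A₂ +
      2 * s * e * (1 - 2 * e) * A₁ + 2 * s * e * d * ((1 - e) * Z - (1 - 2 * e) * A₁)) /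
      (1 - d) := by
  have : 1 - d ≠ 0 := by linarith
  unfold mixLoss
  field_simp
  ring

lemma mixLoss_le {s e Z A₁ A₂ d : ℝ} (hs : 0 ≤ s) (he : 0 ≤ e) (he2 : e ≤ 1 / 2)
    (hA₁ : 0 ≤ A₁) (hAZ : A₁ ≤ Z) (hA₂ : 0 ≤ A₂) (hd : 0 ≤ d) (hd2 : d ≤ 1 / 2) :
    mixLoss s e Z A₁ A₂ d ≤ 2 * s * e ^ 2 * Z + 2 * (A₂ + 2 * s * e * A₁ + 2 * s * e * d * Z) := by
  rw [mixLoss_eq (by linarith)]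
  have hse : 0 ≤ s * e := mul_nonneg hs he
  have h1 : (1 - 2 * s * e * (1 - e)) * A₂ ≤ A₂ := by
    have : 0 ≤ s * e * (1 - e) * A₂ := by
      have : 0 ≤ 1 - e := by linarith
      positivity
    linarith
  have h2 : 2 * s * e * (1 - 2 * e) * A₁ ≤ 2 * s * e * A₁ := by
    have : 0 ≤ s * e * e * A₁ := by positivity
    linarith
  have h3 : 2 * s * e * d * ((1 - e) * Z - (1 - 2 * e) * A₁) ≤ 2 * s * e * d * Z := by
    refine mul_le_mul_of_nonneg_left ?_ (by positivity)
    have h4 : 0 ≤ e * Z := mul_nonneg he (hA₁.trans hAZ)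
    have h5 : 0 ≤ (1 - 2 * e) * A₁ := mul_nonneg (by linarith) hA₁
    linarith
  have hZ : 0 ≤ Z := hA₁.trans hAZ
  have h6 : 0 ≤ A₂ + 2 * s * e * A₁ + 2 * s * e * d * Z := by positivity
  gcongr
  rw [div_le_iff₀ (by linarith)]
  nlinarith

/-- As s ≤ 1 and e(1 - e) ≤ 1/4, the coefficient of A₂ is at least 1/2; dividing by 1 - d ≤ 1 only
increases the nonnegative numerator. The factor 1 - 2e degenerates at e = 1/2, which has to be
excluded later. -/
lemma le_mixLoss {s e Z A₁ A₂ d : ℝ} (hs : 0 ≤ s) (hs1 : s ≤ 1) (he : 0 ≤ e) (he2 : e ≤ 1 / 2)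
    (hA₁ : 0 ≤ A₁) (hAZ : A₁ ≤ Z) (hA₂ : 0 ≤ A₂) (hd : 0 ≤ d) (hd1 : d < 1) :
    2 * s * e ^ 2 * Z + (A₂ / 2 + 2 * s * e * (1 - 2 * e) * (A₁ + d * (Z - A₁))) ≤
      mixLoss s e Z A₁ A₂ d := by
  rw [mixLoss_eq hd1]
  have hse : 0 ≤ s * e := mul_nonneg hs he
  have h12 : 0 ≤ 1 - 2 * e := by linarith
  have hZA : 0 ≤ Z - A₁ := by linarith
  have h1 : A₂ / 2 ≤ (1 - 2 * s * e * (1 - e)) * A₂ := by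
    have h4 : s * (e * (1 - e)) ≤ 1 * (1 / 4) :=
      mul_le_mul hs1 (by nlinarith [sq_nonneg (e - 1 / 2)])
        (mul_nonneg he (by linarith)) zero_le_one
    nlinarith
  have h3 : 2 * s * e * (1 - 2 * e) * (d * (Z - A₁)) ≤
      2 * s * e * d * ((1 - e) * Z - (1 - 2 * e) * A₁) := by
    have h5 : (1 - 2 * e) * (Z - A₁) ≤ (1 - e) * Z - (1 - 2 * e) * A₁ := by
      have : 0 ≤ e * Z := mul_nonneg he (hA₁.trans hAZ)
      linarith
    calc 2 * s * e * (1 - 2 * e) * (d * (Z - A₁)) = 2 * s * e * d * ((1 - 2 * e) * (Z - A₁)) := by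
          ring
      _ ≤ _ := mul_le_mul_of_nonneg_left h5 (by positivity)
  gcongr
  have hlow : 0 ≤ A₂ / 2 + 2 * s * e * (1 - 2 * e) * (A₁ + d * (Z - A₁)) := by positivity
  rw [le_div_iff₀ (by linarith)]
  calc _ ≤ A₂ / 2 + 2 * s * e * (1 - 2 * e) * (A₁ + d * (Z - A₁)) :=
        mul_le_of_le_one_right hlow (by linarith)
    _ = A₂ / 2 + 2 * s * e * (1 - 2 * e) * A₁ + 2 * s * e * (1 - 2 * e) * (d * (Z - A₁)) := by ring
    _ ≤ _ := by gcongr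

variable {γ δ : ℝ} (hγ : 0 < γ) (hδ : 0 < δ)
include hγ hδ

lemma one_le_wtSum : 1 ≤ wtSum γ δ := by
  have := (summable_wt hγ hδ).le_tsum 0 fun n _ => (wt_pos γ δ n).le
  refine le_trans (le_of_eq ?_) this
  simp [wt_eq]

lemma shrinkSum_le_wtSum {κ : ℝ} (hκ : 0 < κ) : shrinkSum γ δ κ ≤ wtSum γ δ :=
  (summable_wt_mul_shrink hγ hδ hκ).tsum_le_tsum (wt_mul_shrink_le γ δ hκ) (summable_wt hγ hδ)

/-- The leading direction has weight 1 and keeps at least half of it. This bounds the coefficient of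
d in the excess from below. -/
lemma half_le_wtSum_sub_shrinkSum {κ : ℝ} (hκ : 0 < κ) (hκ1 : κ ≤ 1) :
    1 / 2 ≤ wtSum γ δ - shrinkSum γ δ κ := by
  unfold wtSum shrinkSum
  rw [← (summable_wt hγ hδ).tsum_sub (summable_wt_mul_shrink hγ hδ hκ)]
  have h := ((summable_wt hγ hδ).sub (summable_wt_mul_shrink hγ hδ hκ)).le_tsum 0
    fun n _ => sub_nonneg.2 (wt_mul_shrink_le γ δ hκ n)
  refine le_trans ?_ h
  have h1 : κ / (1 + κ) ≤ 1 / 2 := by rw [div_le_iff₀ (by linarith)]; linarith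
  simp only [wt_eq, shrink, eig, CharP.cast_eq_zero, zero_add, Real.one_rpow, one_mul]
  linarith

lemma half_le_shrinkSum {κ : ℝ} (hκ1 : 1 ≤ κ) : 1 / 2 ≤ shrinkSum γ δ κ := by
  have hκ : 0 < κ := by linarith
  have h := (summable_wt_mul_shrink hγ hδ hκ).le_tsum 0
    fun n _ => mul_nonneg (wt_pos γ δ n).le (shrink_nonneg γ hκ n)
  refine le_trans ?_ h
  have h1 : 1 / 2 ≤ κ / (1 + κ) := by rw [le_div_iff₀ (by linarith)]; linarith
  simpa [wt_eq, shrink, eig] using h1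

lemma quarter_le_shrinkSqSum {κ : ℝ} (hκ1 : 1 ≤ κ) : 1 / 4 ≤ shrinkSqSum γ δ κ := by
  have hκ : 0 < κ := by linarith
  have h := (summable_wt_mul_shrink_sq hγ hδ hκ).le_tsum 0
    fun n _ => mul_nonneg (wt_pos γ δ n).le (sq_nonneg _)
  refine le_trans ?_ h
  have h1 : 1 / 2 ≤ κ / (1 + κ) := by rw [le_div_iff₀ (by linarith)]; linarith
  simp only [wt_eq, shrink, eig, CharP.cast_eq_zero, zero_add, Real.one_rpow, one_mul]
  nlinarith

omit hγ hδ

lemma shrinkSum_nonneg (γ δ : ℝ) {κ : ℝ} (hκ : 0 < κ) : 0 ≤ shrinkSum γ δ κ :=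
  tsum_nonneg fun n => mul_nonneg (wt_pos γ δ n).le (shrink_nonneg γ hκ n)

lemma shrinkSqSum_nonneg (γ δ κ : ℝ) : 0 ≤ shrinkSqSum γ δ κ :=
  tsum_nonneg fun n => mul_nonneg (wt_pos γ δ n).le (sq_nonneg _)

lemma keepSqSum_nonneg (γ κ : ℝ) : 0 ≤ keepSqSum γ κ := tsum_nonneg fun _ => sq_nonneg _

lemma cutReg_le_one (hγ : 0 < γ) {K : ℝ} (hK : 1 ≤ K) : cutReg γ K ≤ 1 :=
  Real.rpow_le_one_of_one_le_of_nonpos hK (by linarith)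

lemma exists_cutReg_eq (hγ : 0 < γ) {κ : ℝ} (hκ : 0 < κ) (hκ1 : κ ≤ 1) :
    ∃ K : ℝ, 1 ≤ K ∧ cutReg γ K = κ := by
  refine ⟨κ ^ (-(1 / (1 + γ))), Real.one_le_rpow_of_pos_of_le_one_of_nonpos hκ hκ1
    (by simp; linarith), ?_⟩
  have : 1 + γ ≠ 0 := by linarith
  unfold cutReg
  rw [← Real.rpow_mul hκ.le, show -(1 / (1 + γ)) * -(1 + γ) = 1 by field_simp, Real.rpow_one]

/-- The defining equation is solved backwards: prescribe κ and set l = κ (1 - Tr(Σ Σ_κ⁻¹)/n). For K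
≤ n / (2C) the trace term is at most 1/2, so l > 0. -/
lemma exists_limReg_eq_cutReg (hγ : 0 < γ) : ∃ c₁ C : ℝ, 0 < c₁ ∧ 0 < C ∧
    ∀ (K : ℝ) (n : ℕ), 1 ≤ K → 1 ≤ n → K ≤ c₁ * n → ∃ l ∈ Set.Ioo (0 : ℝ) 1,
      limReg γ l n = cutReg γ K ∧ recip n * keepSqSum γ (cutReg γ K) ≤ C * (K / n) ∧
      recip n * keepSqSum γ (cutReg γ K) ≤ 1 / 2 := by
  obtain ⟨C, hC, hkeep⟩ := exists_keepSum_le hγ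
  refine ⟨1 / (2 * C), C, by positivity, hC, fun K n hK hn hKn => ?_⟩
  have hn0 : (0 : ℝ) < n := by exact_mod_cast hn
  have hκ := cutReg_pos γ hK
  have hκ1 := cutReg_le_one hγ hK
  have hle := keepSqSum_le_keepSum hγ hκ
  have hpos : 0 < keepSqSum γ (cutReg γ K) := by
    have := le_keepSqSum hγ hK; linarith
  rw [recip_natCast]
  have h1 : 1 / (n : ℝ) * keepSum γ (cutReg γ K) ≤ C * (K / n) := by
    have := hkeep K hK
    calc 1 / (n : ℝ) * keepSum γ (cutReg γ K) ≤ 1 / (n : ℝ) * (C * K) := by gcongr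
      _ = C * (K / n) := by ring
  have h2 : C * (K / n) ≤ 1 / 2 := by
    have : K / n ≤ 1 / (2 * C) := by rw [div_le_iff₀ hn0]; exact hKn
    calc C * (K / n) ≤ C * (1 / (2 * C)) := by gcongr
      _ = 1 / 2 := by field_simp
  have h3 : 1 / (n : ℝ) * keepSqSum γ (cutReg γ K) ≤ 1 / (n : ℝ) * keepSum γ (cutReg γ K) := by
    gcongr
  -- Strict positivity gives l < 1 even at K = 1, where κ = 1.
  have h4 : 0 < 1 / (n : ℝ) * keepSqSum γ (cutReg γ K) := by positivity
  have hl0 : 0 < cutReg γ K * (1 - 1 / (n : ℝ) * keepSum γ (cutReg γ K)) :=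
    mul_pos hκ (by linarith)
  refine ⟨cutReg γ K * (1 - 1 / (n : ℝ) * keepSum γ (cutReg γ K)), ⟨hl0, ?_⟩, ?_,
    h3.trans h1, h3.trans (h1.trans h2)⟩
  · nlinarith
  · refine limReg_unique hγ hl0 n hκ ?_
    rw [recip_natCast]
    field_simp
    ring

lemma limReg_top (hγ : 0 < γ) {l : ℝ} (hl : 0 < l) : limReg γ l ⊤ = l := by
  refine limReg_unique hγ hl ⊤ hl ?_
  rw [recip_top, zero_mul, add_zero, div_self hl.ne']

lemma nu_pos (hγ : 0 < γ) (hδ : 0 < δ) : 0 < nu γ δ := lt_min (by linarith) (by linarith)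

lemma nu'_pos (hγ : 0 < γ) (hδ : 0 < δ) : 0 < nu' γ δ := lt_min (by linarith) (by linarith)

variable (hγ : 0 < γ) (hδ : 0 < δ)
include hγ hδ

lemma exists_limLoss_le (hcrit : δ ≠ 2 + γ) : ∃ μ : ℝ, 0 < μ ∧ (δ ≠ 1 → μ = nu' γ δ) ∧
    ∃ c₁ C₀ : ℝ, 0 < c₁ ∧ 0 < C₀ ∧ ∀ (ρ : ℝ), ρ < 1 → ∀ (DF : (P : ℕ) → Measure (Vec P))
      (DW : (P : ℕ) → Measure (Vec P × Vec P)), (∀ P : ℕ, PowerLaw γ δ ρ (DF P) (DW P)) →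
      ∀ e : ℝ, 0 ≤ e → e ≤ 1 / 2 → ∀ (K : ℝ) (n : ℕ), 1 ≤ K → 1 ≤ n → K ≤ c₁ * n →
        ∃ l ∈ Set.Ioo (0 : ℝ) 1, limLoss DF DW l n (1 - e) ≤
          2 * (1 - ρ) * e ^ 2 * wtSum γ δ + C₀ * tradeoff (nu γ δ) μ ((1 - ρ) * e) K n := by
  obtain ⟨μ, hμ, hμν, C₂, hC₂, h2⟩ := exists_shrinkSum_le hγ hδ
  obtain ⟨C₃, hC₃, h3⟩ := exists_shrinkSqSum_le hγ hδ hcrit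
  obtain ⟨c₁, C₄, hc₁, hC₄, h4⟩ := exists_limReg_eq_cutReg hγ
  have hZ := one_le_wtSum hγ hδ
  refine ⟨μ, hμ, hμν, c₁, 2 * C₃ + 4 * C₂ + 4 * (C₄ * wtSum γ δ), hc₁, by positivity,
    fun ρ hρ DF DW h e he he2 K n hK hn hKn => ?_⟩
  obtain ⟨l, hl, hreg, hd, hd2⟩ := h4 K n hK hn hKn
  refine ⟨l, hl, ?_⟩
  have hK0 : 0 < K := by linarith
  have hs : 0 ≤ 1 - ρ := by linarith
  have hκ := cutReg_pos γ hK
  rw [limLoss_eq hγ hδ h hl.1, hreg, sub_sub_cancel]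
  refine (mixLoss_le hs he he2 (shrinkSum_nonneg γ δ hκ) (shrinkSum_le_wtSum hγ hδ hκ)
    (shrinkSqSum_nonneg γ δ _) (mul_nonneg (recip_nonneg _) (keepSqSum_nonneg _ _)) hd2).trans ?_
  have hx : 0 ≤ (1 - ρ) * e := mul_nonneg hs he
  have b2 := mul_le_mul_of_nonneg_left (h2 K hK) hx
  have b3 := h3 K hK
  have b4 := mul_le_mul_of_nonneg_left hd (mul_nonneg hx (by linarith : 0 ≤ wtSum γ δ))
  have p1 : 0 ≤ K ^ (-nu γ δ) := by positivity
  have p2 : 0 ≤ (1 - ρ) * e * K ^ (-μ) := by positivity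
  have p3 : 0 ≤ (1 - ρ) * e * (K / n) := by positivity
  have hP : 0 ≤ C₄ * wtSum γ δ := by positivity
  set Q := C₄ * wtSum γ δ with hQ
  unfold tradeoff
  have b4' : (1 - ρ) * e * wtSum γ δ * (recip n * keepSqSum γ (cutReg γ K)) ≤
      Q * ((1 - ρ) * e * (K / n)) := b4.trans (le_of_eq (by rw [hQ]; ring))
  have key : 2 * (C₃ * K ^ (-nu γ δ)) + 4 * (C₂ * ((1 - ρ) * e * K ^ (-μ))) +
      4 * (Q * ((1 - ρ) * e * (K / n))) ≤ (2 * C₃ + 4 * C₂ + 4 * Q) *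
        (K ^ (-nu γ δ) + ((1 - ρ) * e * K ^ (-μ) + (1 - ρ) * e * (K / n))) := by
    nlinarith [mul_nonneg hC₃.le p2, mul_nonneg hC₃.le p3, mul_nonneg hC₂.le p1,
      mul_nonneg hC₂.le p3, mul_nonneg hP p1, mul_nonneg hP p2]
  rw [mul_add ((1 - ρ) * e)]
  linarith

/-- Whatever ridge is chosen, its effective regularizer has a cutoff K, and K/(8n) ≤ d < 1 bounds it
by 8n. -/
lemma exists_le_limLoss : ∃ c₀ : ℝ, 0 < c₀ ∧ ∀ (ρ : ℝ), 0 ≤ ρ → ρ < 1 →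
    ∀ (DF : (P : ℕ) → Measure (Vec P)) (DW : (P : ℕ) → Measure (Vec P × Vec P)),
      (∀ P : ℕ, PowerLaw γ δ ρ (DF P) (DW P)) → ∀ e : ℝ, 0 ≤ e → e ≤ 1 / 2 →
      ∀ l ∈ Set.Ioo (0 : ℝ) 1, ∀ n : ℕ, 1 ≤ n → ∃ K : ℝ, 1 ≤ K ∧ K ≤ 8 * n ∧
        2 * (1 - ρ) * e ^ 2 * wtSum γ δ +
          c₀ * tradeoff (nu γ δ) (nu' γ δ) ((1 - ρ) * e * (1 - 2 * e)) K n ≤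
          limLoss DF DW l n (1 - e) := by
  obtain ⟨c₂, hc₂, h2⟩ := exists_le_shrinkSum hγ hδ
  obtain ⟨c₃, hc₃, h3⟩ := exists_le_shrinkSqSum hγ hδ
  refine ⟨min (c₃ / 2) (min (2 * c₂) (1 / 8)), by positivity,
    fun ρ hρ0 hρ DF DW h e he he2 l hl n hn => ?_⟩
  set c₀ := min (c₃ / 2) (min (2 * c₂) (1 / 8)) with hc₀
  have g3 : c₀ ≤ c₃ / 2 := min_le_left _ _
  have g2 : c₀ ≤ 2 * c₂ := (min_le_right _ _).trans (min_le_left _ _)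
  have g1 : c₀ ≤ 1 / 8 := (min_le_right _ _).trans (min_le_right _ _)
  have hn0 : (0 : ℝ) < n := by exact_mod_cast hn
  have hn1 : (1 : ℝ) ≤ n := by exact_mod_cast hn
  have hs : 0 ≤ 1 - ρ := by linarith
  have hx : 0 ≤ (1 - ρ) * e * (1 - 2 * e) := mul_nonneg (mul_nonneg hs he) (by linarith)
  obtain ⟨-, hκ, -⟩ := limReg_spec hγ hl.1 (n : ℕ∞)
  have hd1 := limReg_df_lt_one hγ hl.1 (n : ℕ∞)
  have hd0 : 0 ≤ recip n * keepSqSum γ (limReg γ l n) :=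
    mul_nonneg (recip_nonneg _) (keepSqSum_nonneg _ _)
  rw [limLoss_eq hγ hδ h hl.1, sub_sub_cancel]
  have hmix := le_mixLoss hs (by linarith) he he2 (shrinkSum_nonneg γ δ hκ)
    (shrinkSum_le_wtSum hγ hδ hκ) (shrinkSqSum_nonneg γ δ (limReg γ l n)) hd0 hd1
  have hZA : 0 ≤ wtSum γ δ - shrinkSum γ δ (limReg γ l n) :=
    sub_nonneg.2 (shrinkSum_le_wtSum hγ hδ hκ)
  set κ := limReg γ l n with hκdef
  unfold tradeoff
  set x := (1 - ρ) * e * (1 - 2 * e) with hxdef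
  rcases le_total κ 1 with hκ1 | hκ1
  · obtain ⟨K, hK, hKκ⟩ := exists_cutReg_eq hγ hκ hκ1
    have hK0 : 0 < K := by linarith
    have hks := le_keepSqSum hγ hK
    rw [hKκ] at hks
    rw [recip_natCast] at hmix hd1
    have hdK : K / 8 / n ≤ 1 / n * keepSqSum γ κ := by
      rw [one_div_mul_eq_div]; gcongr
    refine ⟨K, hK, ?_, le_trans (add_le_add le_rfl ?_) hmix⟩
    · have : K / 8 / n < 1 := hdK.trans_lt hd1
      rw [div_lt_one hn0] at this
      linarith
    · have e3 : c₀ * K ^ (-nu γ δ) ≤ shrinkSqSum γ δ κ / 2 := by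
        have h30 := h3 K hK
        rw [hKκ] at h30
        have : c₀ * K ^ (-nu γ δ) ≤ c₃ / 2 * K ^ (-nu γ δ) := by gcongr
        linarith
      have e2 : c₀ * K ^ (-nu' γ δ) ≤ 2 * shrinkSum γ δ κ := by
        have h20 := h2 K hK
        rw [hKκ] at h20
        have : c₀ * K ^ (-nu' γ δ) ≤ 2 * c₂ * K ^ (-nu' γ δ) := by gcongr
        linarith
      have e1 : c₀ * (K / n) ≤ 2 * (1 / n * keepSqSum γ κ * (wtSum γ δ - shrinkSum γ δ κ)) := by
        have hZA' := half_le_wtSum_sub_shrinkSum hγ hδ hκ hκ1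
        have hle : c₀ * (K / n) ≤ 1 / 8 * (K / n) := by gcongr
        have : K / 8 / n * (1 / 2) ≤
            1 / n * keepSqSum γ κ * (wtSum γ δ - shrinkSum γ δ κ) :=
          mul_le_mul hdK hZA' (by norm_num) (le_trans (by positivity) hdK)
        have r : K / 8 / n = 1 / 8 * (K / n) := by ring
        linarith
      have e12 := mul_le_mul_of_nonneg_left (add_le_add e2 e1) hx
      have r1 : c₀ * (K ^ (-nu γ δ) + x * (K ^ (-nu' γ δ) + K / n)) =
          c₀ * K ^ (-nu γ δ) + x * (c₀ * K ^ (-nu' γ δ) + c₀ * (K / n)) := by ring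
      have r2 : 2 * (1 - ρ) * e * (1 - 2 * e) * (shrinkSum γ δ κ +
          1 / n * keepSqSum γ κ * (wtSum γ δ - shrinkSum γ δ κ)) = x * (2 * shrinkSum γ δ κ +
          2 * (1 / n * keepSqSum γ κ * (wtSum γ δ - shrinkSum γ δ κ))) := by rw [hxdef]; ring
      rw [r1, r2]
      linarith
  -- For κ ≥ 1 nothing is learned: A₁ ≥ 1/2 and A₂ ≥ 1/4 already dominate the trade-off at K = 1.
  · refine ⟨1, le_rfl, by linarith, le_trans (add_le_add le_rfl ?_) hmix⟩
    have a1 := half_le_shrinkSum hγ hδ hκ1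
    have a2 := quarter_le_shrinkSqSum hγ hδ hκ1
    have hdn : 0 ≤ recip n * keepSqSum γ κ * (wtSum γ δ - shrinkSum γ δ κ) := mul_nonneg hd0 hZA
    have hinv : 1 / (n : ℝ) ≤ 1 := by rw [div_le_one hn0]; exact hn1
    rw [Real.one_rpow, Real.one_rpow]
    have r2 : 2 * (1 - ρ) * e * (1 - 2 * e) * (shrinkSum γ δ κ +
        recip n * keepSqSum γ κ * (wtSum γ δ - shrinkSum γ δ κ)) = x * (2 * (shrinkSum γ δ κ +
        recip n * keepSqSum γ κ * (wtSum γ δ - shrinkSum γ δ κ))) := by rw [hxdef]; ring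
    rw [r2]
    calc c₀ * (1 + x * (1 + 1 / n)) ≤ 1 / 8 * (1 + x * (1 + 1)) := by gcongr
      _ ≤ 1 / 8 + x * 1 := by linarith
      _ ≤ _ := by
        refine add_le_add (by linarith) (mul_le_mul_of_nonneg_left (by linarith) hx)

end LossBounds

/-! ### The safety constraint as a lower bound on the mixing fraction -/

section Discount

variable {L τ τ' : ℝ}

/-- The least admissible fraction of data with the safety labels, if the gap is `L`. -/
noncomputable def discount (L τ : ℝ) : ℝ := 1 - √(min τ L / L)

lemma discount_nonneg (hL : 0 < L) : 0 ≤ discount L τ := by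
  unfold discount
  rw [sub_nonneg, Real.sqrt_le_one, div_le_one hL]
  exact min_le_right _ _

lemma discount_le_quarter (hL : 0 < L) (hτ : 9 / 16 * L ≤ τ) : discount L τ ≤ 1 / 4 := by
  unfold discount
  have : 3 / 4 ≤ √(min τ L / L) := by
    refine Real.le_sqrt_of_sq_le ?_
    rw [le_div_iff₀ hL]
    exact le_min (by linarith) (by linarith)
  linarith

lemma infLoss_eq (hL : 0 < L) (hτ : 0 ≤ τ) : infLoss L τ = L * discount L τ ^ 2 := by
  unfold infLoss discount
  rw [Real.sqrt_div (le_min hτ hL.le)]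
  have h := Real.sq_sqrt hL.le
  have h0 : √L ≠ 0 := (Real.sqrt_pos.2 hL).ne'
  calc (√L - √(min τ L)) ^ 2 = √L ^ 2 * (1 - √(min τ L) / √L) ^ 2 := by field_simp
    _ = _ := by rw [h]

lemma discount_le_iff (hL : 0 < L) {e : ℝ} (he : 0 ≤ e) (he1 : e < 1) :
    discount L τ ≤ e ↔ (1 - e) ^ 2 * L ≤ τ := by
  unfold discount
  rw [sub_le_comm, Real.le_sqrt' (by linarith), le_div_iff₀ hL, le_min_iff]
  refine and_iff_left ?_
  exact mul_le_of_le_one_left hL.le (pow_le_one₀ (by linarith) (by linarith))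

lemma discount_antitone (hL : 0 < L) (h : τ ≤ τ') : discount L τ' ≤ discount L τ := by
  unfold discount
  gcongr

/-- Different constraints give the same fraction only if both are saturated, that is, both are at
least L and impose nothing. -/
lemma discount_eq_zero_of_eq (hL : 0 < L) (hτ : 0 ≤ τ) (h : τ < τ')
    (heq : discount L τ' = discount L τ) : discount L τ = 0 := by
  have h0 : 0 ≤ min τ L / L := div_nonneg (le_min hτ hL.le) hL.le
  have h0' : 0 ≤ min τ' L / L := div_nonneg (le_min (hτ.trans h.le) hL.le) hL.le
  unfold discount at heq
  have h1 := (Real.sqrt_inj h0' h0).1 (sub_right_injective heq)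
  rw [div_left_inj' hL.ne'] at h1
  have h2 : min τ L = L := by
    rcases le_total τ L with h3 | h3
    · rw [min_eq_left h3] at h1
      rcases min_choice τ' L with h4 | h4
      · rw [h4] at h1; exact absurd h1 h.ne'
      · rw [min_eq_left h3, ← h1, h4]
    · exact min_eq_right h3
  unfold discount
  rw [h2, div_self hL.ne', Real.sqrt_one, sub_self]

end Discount

/-! ### The optimal loss of a company -/

section Company

variable {γ δ ρ : ℝ} {DF : (P : ℕ) → Measure (Vec P)} {DW : (P : ℕ) → Measure (Vec P × Vec P)}
  (hγ : 0 < γ) (hδ : 0 < δ) (hρ0 : 0 ≤ ρ) (hρ : ρ < 1)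
  (h : ∀ P : ℕ, PowerLaw γ δ ρ (DF P) (DW P))
include hγ hδ hρ h

lemma companyLoss_eq (N : ℕ∞) (τ : ℝ) : companyLoss DF DW N τ =
    sInf {L : ℝ | ∃ e ∈ Set.Icc (discount (2 * (1 - ρ) * wtSum γ δ) τ) (1 / 2),
      ∃ l ∈ Set.Ioo (0 : ℝ) 1, L = limLoss DF DW l N (1 - e)} := by
  have hZ := one_le_wtSum hγ hδ
  have hs : 0 < 1 - ρ := by linarith
  have hL : 0 < 2 * (1 - ρ) * wtSum γ δ := by positivity
  unfold companyLoss
  congr 1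
  ext x
  constructor
  · rintro ⟨α, hα, l, hl, hsafe, rfl⟩
    rw [limSafety_eq hγ hδ h] at hsafe
    have h1 := hα.1
    have h2 := hα.2
    norm_num at h1
    refine ⟨1 - α, ⟨(discount_le_iff hL (by linarith) (by linarith)).2 ?_, by linarith⟩,
      l, hl, ?_⟩
    · rwa [sub_sub_cancel]
    · rw [sub_sub_cancel]
  · rintro ⟨e, he, l, hl, rfl⟩
    have he0 : 0 ≤ e := (discount_nonneg hL).trans he.1
    have he1 := he.2
    refine ⟨1 - e, ⟨by norm_num; linarith, by linarith⟩, l, hl, ?_, rfl⟩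
    rw [limSafety_eq hγ hδ h]
    exact (discount_le_iff hL he0 (by linarith)).1 he.1

include hρ0

lemma le_limLoss (N : ℕ∞) {e l : ℝ} (he : 0 ≤ e) (he2 : e ≤ 1 / 2) (hl : 0 < l) :
    2 * (1 - ρ) * e ^ 2 * wtSum γ δ ≤ limLoss DF DW l N (1 - e) := by
  obtain ⟨-, hκ, -⟩ := limReg_spec hγ hl N
  have hd0 : 0 ≤ recip N * keepSqSum γ (limReg γ l N) :=
    mul_nonneg (recip_nonneg _) (keepSqSum_nonneg _ _)
  rw [limLoss_eq hγ hδ h hl, sub_sub_cancel]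
  refine le_trans ?_ (le_mixLoss (by linarith) (by linarith) he he2 (shrinkSum_nonneg γ δ hκ)
    (shrinkSum_le_wtSum hγ hδ hκ) (shrinkSqSum_nonneg γ δ _) hd0 (limReg_df_lt_one hγ hl N))
  have h1 := shrinkSqSum_nonneg γ δ (limReg γ l N)
  have h2 := shrinkSum_nonneg γ δ hκ
  have h3 := sub_nonneg.2 (shrinkSum_le_wtSum hγ hδ hκ)
  have h4 : 0 ≤ 1 - ρ := by linarith
  have h5 : 0 ≤ 1 - 2 * e := by linarith
  exact le_add_of_nonneg_right (by positivity)

lemma companyLoss_le (N : ℕ∞) {τ l e : ℝ}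
    (he : discount (2 * (1 - ρ) * wtSum γ δ) τ ≤ e) (he2 : e ≤ 1 / 2)
    (hl : l ∈ Set.Ioo (0 : ℝ) 1) : companyLoss DF DW N τ ≤ limLoss DF DW l N (1 - e) := by
  have hZ := one_le_wtSum hγ hδ
  have hs : 0 < 1 - ρ := by linarith
  have hL : 0 < 2 * (1 - ρ) * wtSum γ δ := by positivity
  rw [companyLoss_eq hγ hδ hρ h N τ]
  refine csInf_le ⟨0, ?_⟩ ⟨e, ⟨he, he2⟩, l, hl, rfl⟩
  rintro x ⟨e', he', l', hl', rfl⟩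
  exact le_trans (by positivity)
    (le_limLoss hγ hδ hρ0 hρ h N ((discount_nonneg hL).trans he'.1) he'.2 hl'.1)

omit hρ0 in
lemma exists_limLoss_lt (N : ℕ∞) {τ : ℝ} (hτ : 9 / 16 * (2 * (1 - ρ) * wtSum γ δ) ≤ τ) {x : ℝ}
    (hx : companyLoss DF DW N τ < x) : ∃ e, discount (2 * (1 - ρ) * wtSum γ δ) τ ≤ e ∧
      e ≤ 1 / 2 ∧ ∃ l ∈ Set.Ioo (0 : ℝ) 1, limLoss DF DW l N (1 - e) < x := by
  have hZ := one_le_wtSum hγ hδ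
  have hs : 0 < 1 - ρ := by linarith
  have hL : 0 < 2 * (1 - ρ) * wtSum γ δ := by positivity
  rw [companyLoss_eq hγ hδ hρ h N τ] at hx
  have hq := discount_le_quarter hL hτ
  obtain ⟨y, ⟨e, he, l, hl, rfl⟩, hy⟩ := exists_lt_of_csInf_lt
    (by exact ⟨limLoss DF DW (1 / 2) N (1 - 1 / 2), 1 / 2, ⟨by linarith, le_rfl⟩, 1 / 2,
      ⟨by norm_num, by norm_num⟩, rfl⟩) hx
  exact ⟨e, he.1, he.2, l, hl, hy⟩

/-- With infinite data κ = l and d = 0, so letting l = K^(-1-γ) tend to 0 at the least admissible e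
removes the excess; conversely every admissible choice costs at least L e², which is smallest at
that e. -/
lemma companyLoss_top (hcrit : δ ≠ 2 + γ) {τ : ℝ}
    (hτ : 9 / 16 * (2 * (1 - ρ) * wtSum γ δ) ≤ τ) :
    companyLoss DF DW ⊤ τ = infLoss (2 * (1 - ρ) * wtSum γ δ) τ := by
  have hZ := one_le_wtSum hγ hδ
  have hs : 0 < 1 - ρ := by linarith
  have hL : 0 < 2 * (1 - ρ) * wtSum γ δ := by positivity
  have hτ0 : 0 ≤ τ := by linarith
  rw [infLoss_eq hL hτ0]
  set e₀ := discount (2 * (1 - ρ) * wtSum γ δ) τ with he₀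
  have he0 : 0 ≤ e₀ := discount_nonneg hL
  have he1 : e₀ ≤ 1 / 4 := discount_le_quarter hL hτ
  refine le_antisymm ?_ ?_
  · refine le_of_forall_pos_le_add fun ε hε => ?_
    obtain ⟨μ, hμ, -, C₂, hC₂, h2⟩ := exists_shrinkSum_le hγ hδ
    obtain ⟨C₃, hC₃, h3⟩ := exists_shrinkSqSum_le hγ hδ hcrit
    obtain ⟨K, ⟨a3, a2⟩, hK⟩ := (((eventually_mul_rpow_neg_le (nu_pos hγ hδ) (2 * C₃)
      (half_pos hε)).and (eventually_mul_rpow_neg_le hμ (4 * (1 - ρ) * e₀ * C₂)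
      (half_pos hε))).and (eventually_gt_atTop 1)).exists
    have hκ := cutReg_pos γ hK.le
    have hl : cutReg γ K ∈ Set.Ioo (0 : ℝ) 1 :=
      ⟨hκ, Real.rpow_lt_one_of_one_lt_of_neg hK (by linarith)⟩
    refine (companyLoss_le hγ hδ hρ0 hρ h ⊤ he₀.ge (by linarith) hl).trans ?_
    rw [limLoss_eq hγ hδ h hl.1, sub_sub_cancel, limReg_top hγ hκ, recip_top, zero_mul]
    refine (mixLoss_le hs.le he0 (by linarith) (shrinkSum_nonneg γ δ hκ)
      (shrinkSum_le_wtSum hγ hδ hκ) (shrinkSqSum_nonneg γ δ _) le_rfl (by norm_num)).trans ?_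
    have b3 := h3 K hK.le
    have b2 := mul_le_mul_of_nonneg_left (h2 K hK.le)
      (by positivity : 0 ≤ 4 * (1 - ρ) * e₀)
    linarith
  · by_contra! hlt
    obtain ⟨e, he, he2, l, hl, hlt'⟩ := exists_limLoss_lt hγ hδ hρ h ⊤ hτ hlt
    have h1 := le_limLoss hγ hδ hρ0 hρ h ⊤ (he0.trans he) he2 hl.1
    have h2 : e₀ ^ 2 ≤ e ^ 2 := pow_le_pow_left₀ he0 he 2
    have h3 := mul_le_mul_of_nonneg_left h2 hL.le
    linarith

end Company

/-! ### From the trade-off to the market-entry threshold -/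

lemma sInf_natCast_eq {p : ℕ → Prop} (hp : ∃ n, p n) :
    ∃ n : ℕ, sInf {N : ℕ∞ | ∃ n : ℕ, N = n ∧ p n} = n ∧ p n ∧ ∀ m, p m → n ≤ m := by
  classical
  refine ⟨Nat.find hp, le_antisymm (sInf_le ⟨_, rfl, Nat.find_spec hp⟩) (le_sInf ?_),
    Nat.find_spec hp, fun m hm => Nat.find_min' hp hm⟩
  rintro _ ⟨m, rfl, hm⟩
  exact_mod_cast Nat.find_min' hp hm

lemma sInf_natCast_eq_top {p : ℕ → Prop} (hp : ∀ n, ¬p n) :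
    sInf {N : ℕ∞ | ∃ n : ℕ, N = n ∧ p n} = ⊤ := by
  refine sInf_eq_top.2 ?_
  rintro _ ⟨n, -, hn⟩
  exact absurd hn (hp n)

lemma tradeoff_mono {ν μ X X' K : ℝ} {n : ℕ} (hK : 1 ≤ K) (h : X ≤ X') :
    tradeoff ν μ X K n ≤ tradeoff ν μ X' K n := by
  have hK0 : 0 < K := by linarith
  unfold tradeoff
  gcongr

lemma mul_tradeoff_le {ν μ X K b : ℝ} {n : ℕ} (hK : 1 ≤ K) (hb : b ≤ 1) :
    b * tradeoff ν μ X K n ≤ tradeoff ν μ (b * X) K n := by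
  have hK0 : 0 < K := by linarith
  unfold tradeoff
  have : b * K ^ (-ν) ≤ K ^ (-ν) := mul_le_of_le_one_left (by positivity) hb
  rw [mul_add, ← mul_assoc]
  linarith

/-- With G_E = L* e², this identifies √(G_E (1 - ρ)) with the size s e of the mixing penalty, up to
a constant depending on γ and δ only. -/
lemma penalty_eq {s Z e : ℝ} (hs : 0 ≤ s) (he : 0 ≤ e) :
    (2 * s * Z * e ^ 2) ^ (1 / 2 : ℝ) * s ^ (1 / 2 : ℝ) = √(2 * Z) * (s * e) := by
  rw [← Real.sqrt_eq_rpow, ← Real.sqrt_eq_rpow, show 2 * s * Z * e ^ 2 = e ^ 2 * (s * (2 * Z)) by ring,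
    Real.sqrt_mul (sq_nonneg e), Real.sqrt_sq he, Real.sqrt_mul hs]
  have := Real.mul_self_sqrt hs
  calc e * (√s * √(2 * Z)) * √s = √(2 * Z) * ((√s * √s) * e) := by ring
    _ = _ := by rw [this]

lemma mul_rpow_half_rpow {G s a : ℝ} (hG : 0 ≤ G) (hs : 0 ≤ s) (b : ℝ) :
    (G ^ (1 / 2 : ℝ) * s ^ (1 / 2 : ℝ)) ^ (a / b) = G ^ (a / (2 * b)) * s ^ (a / (2 * b)) := by
  rw [Real.mul_rpow (by positivity) (by positivity), ← Real.rpow_mul hG, ← Real.rpow_mul hs,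
    div_mul_div_comm, one_mul]

section Entry

variable {γ δ : ℝ} (hγ : 0 < γ) (hδ : 0 < δ)
include hγ hδ

/-- The entrant mixes as little as its constraint allows and uses the ridge that realizes the cutoff
K. Since √(2Z) ≥ 1, the penalty used here only overestimates s e. -/
lemma exists_companyLoss_le_of_reaches (hcrit : δ ≠ 2 + γ) : ∃ μ : ℝ, 0 < μ ∧
    (δ ≠ 1 → μ = nu' γ δ) ∧ ∃ c₁ C₀ : ℝ, 0 < c₁ ∧ 0 < C₀ ∧ ∀ (ρ : ℝ), 0 ≤ ρ → ρ < 1 →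
      ∀ (DF : (P : ℕ) → Measure (Vec P)) (DW : (P : ℕ) → Measure (Vec P × Vec P)),
      (∀ P : ℕ, PowerLaw γ δ ρ (DF P) (DW P)) → ∀ τI τE eE D : ℝ,
      9 / 16 * (2 * (1 - ρ) * wtSum γ δ) ≤ τI → τI < τE →
      eE = discount (2 * (1 - ρ) * wtSum γ δ) τE →
      D = infLoss (2 * (1 - ρ) * wtSum γ δ) τI - infLoss (2 * (1 - ρ) * wtSum γ δ) τE →
      ∀ n : ℕ, Reaches (nu γ δ) μ c₁ C₀ (√(2 * wtSum γ δ) * ((1 - ρ) * eE)) D n →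
        companyLoss DF DW n τE ≤ companyLoss DF DW ⊤ τI := by
  obtain ⟨μ, hμ, hμν, c₁, C₀, hc₁, hC₀, hup⟩ := exists_limLoss_le hγ hδ hcrit
  refine ⟨μ, hμ, hμν, c₁, C₀, hc₁, hC₀, fun ρ hρ0 hρ DF DW h τI τE eE D hτI hτ heE hD n hn => ?_⟩
  have hZ := one_le_wtSum hγ hδ
  have hs : 0 < 1 - ρ := by linarith
  have hL : 0 < 2 * (1 - ρ) * wtSum γ δ := by positivity
  have hτI0 : 0 ≤ τI := by linarith
  have he0 : 0 ≤ eE := heE ▸ discount_nonneg hL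
  have he1 : eE ≤ 1 / 4 := heE ▸ discount_le_quarter hL (by linarith)
  obtain ⟨hn1, K, hK, hKn, hle⟩ := hn
  obtain ⟨l, hl, hloss⟩ := hup ρ hρ DF DW h eE he0 (by linarith) K n hK hn1 hKn
  have hsqrt : 1 ≤ √(2 * wtSum γ δ) := Real.one_le_sqrt.2 (by linarith)
  have htr : C₀ * tradeoff (nu γ δ) μ ((1 - ρ) * eE) K n ≤ D :=
    (mul_le_mul_of_nonneg_left (tradeoff_mono hK
      (le_mul_of_one_le_left (by positivity) hsqrt)) hC₀.le).trans hle
  rw [companyLoss_top hγ hδ hρ0 hρ h hcrit hτI]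
  refine (companyLoss_le hγ hδ hρ0 hρ h n heE.ge (by linarith) hl).trans (hloss.trans ?_)
  rw [infLoss_eq hL (by linarith : 0 ≤ τE), ← heE] at hD
  linarith

/-- A near-optimal choice may use more mixing than necessary, but that increases both the
irreducible loss and the penalty; so its cutoff also witnesses the trade-off for the least
admissible e. -/
lemma exists_reaches_of_companyLoss_le (hcrit : δ ≠ 2 + γ) : ∃ c₀ : ℝ, 0 < c₀ ∧
      ∀ (ρ : ℝ), 0 ≤ ρ → ρ < 1 →
      ∀ (DF : (P : ℕ) → Measure (Vec P)) (DW : (P : ℕ) → Measure (Vec P × Vec P)),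
      (∀ P : ℕ, PowerLaw γ δ ρ (DF P) (DW P)) → ∀ τI τE eE D : ℝ,
      9 / 16 * (2 * (1 - ρ) * wtSum γ δ) ≤ τI → τI < τE →
      eE = discount (2 * (1 - ρ) * wtSum γ δ) τE →
      D = infLoss (2 * (1 - ρ) * wtSum γ δ) τI - infLoss (2 * (1 - ρ) * wtSum γ δ) τE → 0 < D →
      ∀ n : ℕ, 1 ≤ n → companyLoss DF DW n τE ≤ companyLoss DF DW ⊤ τI →
        Reaches (nu γ δ) (nu' γ δ) 8 c₀ (√(2 * wtSum γ δ) * ((1 - ρ) * eE)) D n := by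
  obtain ⟨c₀, hc₀, hlow⟩ := exists_le_limLoss hγ hδ
  have hZ := one_le_wtSum hγ hδ
  have hsqrt : 1 ≤ √(2 * wtSum γ δ) := Real.one_le_sqrt.2 (by linarith)
  set r := √(2 * wtSum γ δ) with hr
  -- The factor 1/(4r) accounts for 1 - 2e ≥ 1/4 and for r = √(2Z); the 1/2 pays for the slack D
  -- granted because the infimum need not be attained.
  refine ⟨c₀ * (1 / (4 * r)) / 2, by positivity,
    fun ρ hρ0 hρ DF DW h τI τE eE D hτI hτ heE hD hD0 n hn hle => ?_⟩
  have hs : 0 < 1 - ρ := by linarith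
  have hL : 0 < 2 * (1 - ρ) * wtSum γ δ := by positivity
  have hτI0 : 0 ≤ τI := by linarith
  have heE0 : 0 ≤ eE := heE ▸ discount_nonneg hL
  have heI1 : discount (2 * (1 - ρ) * wtSum γ δ) τI ≤ 1 / 4 := discount_le_quarter hL hτI
  have heI0 : 0 ≤ discount (2 * (1 - ρ) * wtSum γ δ) τI := discount_nonneg hL
  rw [companyLoss_top hγ hδ hρ0 hρ h hcrit hτI] at hle
  rw [infLoss_eq hL hτI0] at hle hD
  rw [infLoss_eq hL (by linarith), ← heE] at hD
  set eI := discount (2 * (1 - ρ) * wtSum γ δ) τI with heI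
  obtain ⟨e, he, he2, l, hl, hlt⟩ := exists_limLoss_lt hγ hδ hρ h n (by linarith : _ ≤ τE)
    (lt_add_of_le_of_pos hle hD0)
  rw [← heE] at he
  have he0 : 0 ≤ e := heE0.trans he
  obtain ⟨K, hK, hKn, hloss⟩ := hlow ρ hρ0 hρ DF DW h e he0 he2 l hl n hn
  have hK0 : 0 < K := by linarith
  have hbase := le_limLoss hγ hδ hρ0 hρ h n he0 he2 hl.1
  -- The loss stays below G_I + D ≤ 2 G_I ≤ 2 L*/16, hence e² < 1/8.
  have he3 : e ≤ 3 / 8 := by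
    have h1 : 2 * (1 - ρ) * wtSum γ δ * e ^ 2 <
        2 * (1 - ρ) * wtSum γ δ * (2 * (1 / 4) ^ 2) := by
      have h2 : 2 * (1 - ρ) * wtSum γ δ * eI ^ 2 ≤ 2 * (1 - ρ) * wtSum γ δ * (1 / 4) ^ 2 := by
        gcongr
      have h3 : 0 ≤ 2 * (1 - ρ) * wtSum γ δ * eE ^ 2 := by positivity
      linarith
    have h4 := lt_of_mul_lt_mul_left h1 hL.le
    nlinarith
  have hX : 1 / (4 * r) * (r * ((1 - ρ) * eE)) ≤ (1 - ρ) * e * (1 - 2 * e) := by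
    calc 1 / (4 * r) * (r * ((1 - ρ) * eE)) = (1 - ρ) * eE * (1 / 4) := by field_simp
      _ ≤ (1 - ρ) * e * (1 - 2 * e) := by
        have : 1 / 4 ≤ 1 - 2 * e := by linarith
        gcongr
  have hb : 1 / (4 * r) ≤ 1 := by rw [div_le_one (by positivity)]; linarith
  have htr := mul_le_mul_of_nonneg_left
    ((mul_tradeoff_le (ν := nu γ δ) (μ := nu' γ δ) (n := n) hK hb).trans (tradeoff_mono hK hX))
    hc₀.le
  have hee : 2 * (1 - ρ) * wtSum γ δ * eE ^ 2 ≤ 2 * (1 - ρ) * wtSum γ δ * e ^ 2 := by gcongr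
  refine ⟨hn, K, hK, hKn, ?_⟩
  linarith

/-- Cutoffs are at most 8n, so the bias is at least of order (8n)^(-ν), uniformly in the choices of
the company. -/
lemma companyLoss_pos {ρ : ℝ} (hρ0 : 0 ≤ ρ) (hρ : ρ < 1) {DF : (P : ℕ) → Measure (Vec P)}
    {DW : (P : ℕ) → Measure (Vec P × Vec P)} (h : ∀ P : ℕ, PowerLaw γ δ ρ (DF P) (DW P)) {τ : ℝ}
    (hτ : 9 / 16 * (2 * (1 - ρ) * wtSum γ δ) ≤ τ) {n : ℕ} (hn : 1 ≤ n) :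
    0 < companyLoss DF DW n τ := by
  obtain ⟨c₀, hc₀, hlow⟩ := exists_le_limLoss hγ hδ
  have hZ := one_le_wtSum hγ hδ
  have hs : 0 < 1 - ρ := by linarith
  have hL : 0 < 2 * (1 - ρ) * wtSum γ δ := by positivity
  have hn0 : (0 : ℝ) < n := by exact_mod_cast hn
  by_contra! hle
  have hpos : 0 < c₀ * (8 * (n : ℝ)) ^ (-nu γ δ) := by positivity
  obtain ⟨e, he, he2, l, hl, hlt⟩ := exists_limLoss_lt hγ hδ hρ h n hτ (hle.trans_lt hpos)
  have he0 : 0 ≤ e := (discount_nonneg hL).trans he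
  obtain ⟨K, hK, hKn, hloss⟩ := hlow ρ hρ0 hρ DF DW h e he0 he2 l hl n hn
  have hK0 : 0 < K := by linarith
  have h1 : (8 * (n : ℝ)) ^ (-nu γ δ) ≤ tradeoff (nu γ δ) (nu' γ δ)
      ((1 - ρ) * e * (1 - 2 * e)) K n := by
    have h2 := Real.rpow_le_rpow_of_nonpos hK0 hKn (neg_nonpos.2 (nu_pos hγ hδ).le)
    have h3 : 0 ≤ (1 - ρ) * e * (1 - 2 * e) := mul_nonneg (by positivity) (by linarith)
    unfold tradeoff
    exact h2.trans (le_add_of_nonneg_right (by positivity))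
  have h4 := mul_le_mul_of_nonneg_left h1 hc₀.le
  have h5 : 0 ≤ 2 * (1 - ρ) * e ^ 2 * wtSum γ δ := by positivity
  linarith

end Entry

lemma nu'_lt_nu {γ δ : ℝ} (hγ : 0 < γ) (h : 1 < δ) : nu' γ δ < nu γ δ := by
  unfold nu nu'
  rw [min_eq_left (by linarith)]
  exact lt_min (by linarith) (by linarith)

lemma nu_eq_nu' {γ δ : ℝ} (hγ : 0 < γ) (h : δ < 1) : nu γ δ = nu' γ δ := by
  unfold nu nu'
  rw [min_eq_right (by linarith), min_eq_right (by linarith)]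

/-- Explains the boundary between the second and third regimes: above it, the penalty at K =
D^(-1/ν) does not exceed D. -/
lemma mul_rpow_le_of_rpow_le {ν ν' X D : ℝ} (hν' : 0 < ν') (hνν' : ν' < ν) (hX : 0 ≤ X)
    (hD : 0 < D) (h : X ^ (ν / (ν - ν')) ≤ D) : X * D ^ (ν' / ν) ≤ D := by
  have hν : 0 < ν := hν'.trans hνν'
  have hsub : 0 < ν - ν' := by linarith
  have h1 : X ≤ D ^ ((ν - ν') / ν) := by
    have h2 := Real.rpow_le_rpow (by positivity) h (by positivity : 0 ≤ (ν - ν') / ν)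
    rwa [← Real.rpow_mul hX, show ν / (ν - ν') * ((ν - ν') / ν) = 1 by field_simp,
      Real.rpow_one] at h2
  calc X * D ^ (ν' / ν) ≤ D ^ ((ν - ν') / ν) * D ^ (ν' / ν) := by gcongr
    _ = D := by
      rw [← Real.rpow_add hD, ← add_div, sub_add_cancel, div_self hν.ne', Real.rpow_one]

end MarketEntry

/-! ### Assembly of the regimes -/

theorem theorem5 (γ δ : ℝ) (hγ : 0 < γ) (hδ : 0 < δ) (hcrit : δ ≠ 2 + γ) :
    ∃ c C : ℝ, 0 < c ∧ 0 < C ∧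
      ∀ (ρ : ℝ), 0 ≤ ρ → ρ < 1 →
      ∀ (DF : (P : ℕ) → Measure (Vec P)) (DW : (P : ℕ) → Measure (Vec P × Vec P)),
      (∀ P : ℕ, PowerLaw γ δ ρ (DF P) (DW P)) →
      ∀ (τI τE : ℝ), τI < τE → limSafety DF DW 0.75 ≤ τI →
      ∀ (L GI GE D ν ν' : ℝ) (Nstar : ℕ∞),
      L = limGap DF DW → GI = infLoss L τI → GE = infLoss L τE → D = GI - GE →
      ν = nu γ δ → ν' = nu' γ δ → Nstar = entryThreshold ⊤ τI τE DW DF →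
      -- the quantities at `P = ∞` are well defined
      (∀ α ∈ Set.Icc (0.5 : ℝ) 1, ∀ l ∈ Set.Ioo (0 : ℝ) 1, ∀ N : ℕ∞, 1 ≤ N →
        Tendsto (fun P : ℕ => meanLoss (DF P) (DW P) l N α) atTop (𝓝 (limLoss DF DW l N α))) ∧
      (∀ α ∈ Set.Icc (0.5 : ℝ) 1,
        Tendsto (fun P : ℕ => meanSafety (DF P) (DW P) α) atTop (𝓝 (limSafety DF DW α))) ∧
      Tendsto (fun P : ℕ => meanGap (DF P) (DW P)) atTop (𝓝 L) ∧
      -- `L*(ρ) = Θ(1 - ρ)`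
      (c * (1 - ρ) ≤ L ∧ L ≤ C * (1 - ρ)) ∧
      -- the degenerate case `D = 0`, and the three regimes for `D > 0`
      0 ≤ D ∧
      (D = 0 → Nstar = ⊤) ∧
      (0 < D → ∃ n : ℕ, Nstar = n ∧
        (GE ^ (1 / 2 : ℝ) * (1 - ρ) ^ (1 / 2 : ℝ) ≤ D →
          c * D ^ (-(1 / ν)) ≤ n ∧ n ≤ C * D ^ (-(1 / ν))) ∧
        (δ ≠ 1 →
          (1 < δ → GE ^ (ν / (2 * (ν - ν'))) * (1 - ρ) ^ (ν / (2 * (ν - ν'))) ≤ D) →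
          D ≤ GE ^ (1 / 2 : ℝ) * (1 - ρ) ^ (1 / 2 : ℝ) →
          c * (D ^ (-((ν + 1) / ν)) * GE ^ (1 / 2 : ℝ) * (1 - ρ) ^ (1 / 2 : ℝ)) ≤ n ∧
            n ≤ C * (D ^ (-((ν + 1) / ν)) * GE ^ (1 / 2 : ℝ) * (1 - ρ) ^ (1 / 2 : ℝ))) ∧
        (1 < δ → D ≤ GE ^ (ν / (2 * (ν - ν'))) * (1 - ρ) ^ (ν / (2 * (ν - ν'))) →
          c * (D * GE ^ (-(1 / 2) : ℝ) * (1 - ρ) ^ (-(1 / 2) : ℝ)) ^ (-((ν' + 1) / ν')) ≤ n ∧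
            n ≤ C * (D * GE ^ (-(1 / 2) : ℝ) * (1 - ρ) ^ (-(1 / 2) : ℝ)) ^
              (-((ν' + 1) / ν')))) := by
  have hν := nu_pos hγ hδ
  have hν' := nu'_pos hγ hδ
  have hZ := one_le_wtSum hγ hδ
  obtain ⟨μ, hμ, hμν, c₁, C₀, hc₁, hC₀, hsuff⟩ := exists_companyLoss_le_of_reaches hγ hδ hcrit
  obtain ⟨c₀, hc₀, hnec⟩ := exists_reaches_of_companyLoss_le hγ hδ hcrit
  set M := 2 * wtSum γ δ with hM
  have hM1 : 1 ≤ M := by linarith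
  have hM0 : 0 < M := by linarith
  obtain ⟨U₁, hU₁, hu1⟩ := reaches_of_penalty_le hν hμ hc₁ hC₀ M
  obtain ⟨U₂, hU₂, hu2⟩ := reaches_of_le_penalty hν hν' hc₁ hC₀ M
  obtain ⟨U₃, hU₃, hu3⟩ : ∃ U₃ : ℝ, 0 < U₃ ∧ (1 < δ → ∀ X D : ℝ, 0 < X → X ≤ M → 0 < D →
      D ≤ X ^ (nu γ δ / (nu γ δ - nu' γ δ)) → ∃ n : ℕ, Reaches (nu γ δ) (nu' γ δ) c₁ C₀ X D n ∧
        (n : ℝ) ≤ U₃ * (D / X) ^ (-((nu' γ δ + 1) / nu' γ δ))) := by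
    by_cases h1 : 1 < δ
    · obtain ⟨U₃, hU₃, hu3⟩ := reaches_of_le_penalty_rpow hν' (nu'_lt_nu hγ h1) hc₁ hC₀ hM0
      exact ⟨U₃, hU₃, fun _ => hu3⟩
    · exact ⟨1, one_pos, fun h => absurd h h1⟩
  set l₁ := c₀ ^ (1 / nu γ δ) / 8 with hl₁
  set l₂ := c₀ * c₀ ^ (1 / nu γ δ) with hl₂
  set l₃ := c₀ * c₀ ^ (1 / nu' γ δ) with hl₃
  refine ⟨min 1 (min l₁ (min l₂ l₃)), M + U₁ + U₂ + U₃, by positivity, by positivity, ?_⟩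
  set c := min 1 (min l₁ (min l₂ l₃)) with hc
  have hcM : c ≤ 1 := min_le_left _ _
  have hcl₁ : c ≤ l₁ := (min_le_right _ _).trans (min_le_left _ _)
  have hcl₂ : c ≤ l₂ := (min_le_right _ _).trans ((min_le_right _ _).trans (min_le_left _ _))
  have hcl₃ : c ≤ l₃ := (min_le_right _ _).trans ((min_le_right _ _).trans (min_le_right _ _))
  set C := M + U₁ + U₂ + U₃ with hC
  have hCM : M ≤ C := by linarith
  have hCU₁ : U₁ ≤ C := by linarith
  have hCU₂ : U₂ ≤ C := by linarith
  have hCU₃ : U₃ ≤ C := by linarith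
  intro ρ hρ0 hρ DF DW h τI τE hτ hsafe L GI GE D ν ν' Nstar hL hGI hGE hD hνdef hν'def hN
  have hgap := limGap_eq hγ hδ h
  rw [hgap] at hL
  have hs : 0 < 1 - ρ := by linarith
  have hs1 : 1 - ρ ≤ 1 := by linarith
  have hL0 : 0 < L := by rw [hL]; positivity
  -- The safety loss at α = 3/4 is (3/4)² L.
  have hτI : 9 / 16 * L ≤ τI := by
    rw [limSafety_eq hγ hδ h, ← hL] at hsafe
    norm_num at hsafe
    linarith
  have hτI0 : 0 ≤ τI := by linarith
  have heI1 : discount L τI ≤ 1 / 4 := discount_le_quarter hL0 hτI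
  have heI0 : 0 ≤ discount L τI := discount_nonneg hL0
  have heE0 : 0 ≤ discount L τE := discount_nonneg hL0
  have heEI : discount L τE ≤ discount L τI := discount_antitone hL0 hτ.le
  have hD' : D = infLoss L τI - infLoss L τE := by rw [hD, hGI, hGE]
  rw [infLoss_eq hL0 hτI0] at hGI
  rw [infLoss_eq hL0 (by linarith)] at hGE
  have hGE0 : 0 ≤ GE := by rw [hGE]; positivity
  have hLM : L ≤ M := by
    rw [hL, mul_right_comm]
    exact mul_le_of_le_one_right hM0.le hs1
  have hDM : D ≤ M := by
    have : L * discount L τI ^ 2 ≤ L * 1 :=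
      mul_le_mul_of_nonneg_left (pow_le_one₀ heI0 (by linarith)) hL0.le
    linarith
  set X := GE ^ (1 / 2 : ℝ) * (1 - ρ) ^ (1 / 2 : ℝ) with hX
  have hXe : X = √M * ((1 - ρ) * discount L τE) := by
    rw [hX, hGE, hM, hL]
    exact penalty_eq hs.le (hL ▸ heE0)
  have hX0 : 0 ≤ X := by positivity
  have hXM : X ≤ M := by
    have h1 : √M ≤ M := Real.sqrt_le_self_iff.2 (Or.inr hM1)
    have h2 : (1 - ρ) * discount L τE ≤ 1 := mul_le_one₀ hs1 heE0 (by linarith)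
    rw [hXe]
    exact (mul_le_of_le_one_right (Real.sqrt_nonneg _) h2).trans h1
  have hD0 : 0 ≤ D := by
    rw [hD, hGI, hGE, sub_nonneg]
    gcongr
  refine ⟨fun α _ l hl N _ => ?_, fun α _ => ?_, ?_, ⟨?_, ?_⟩, hD0, fun hDz => ?_, fun hDp => ?_⟩
  · rw [limLoss_eq hγ hδ h hl.1]
    exact tendsto_meanLoss hγ hδ h hl.1 N α
  · rw [limSafety_eq hγ hδ h]
    exact tendsto_meanSafety hγ hδ h α
  · rw [hL]
    exact tendsto_meanGap hγ hδ h
  · calc c * (1 - ρ) ≤ 1 * (1 - ρ) := mul_le_mul_of_nonneg_right hcM hs.le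
      _ ≤ M * (1 - ρ) := mul_le_mul_of_nonneg_right hM1 hs.le
      _ = L := by rw [hL, hM]; ring
  · calc L = M * (1 - ρ) := by rw [hL, hM]; ring
      _ ≤ C * (1 - ρ) := mul_le_mul_of_nonneg_right hCM hs.le
  -- D = 0 means that neither constraint binds: the incumbent's loss is 0, while the entrant's is
  -- positive for every finite n.
  · have heq : discount L τE = discount L τI := by
      have h1 : L * discount L τE ^ 2 = L * discount L τI ^ 2 := by linarith
      exact (pow_left_inj₀ heE0 heI0 two_ne_zero).1 (mul_left_cancel₀ hL0.ne' h1)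
    have hz := discount_eq_zero_of_eq hL0 hτI0 hτ heq
    have htop : companyLoss DF DW ⊤ τI = 0 := by
      rw [companyLoss_top hγ hδ hρ0 hρ h hcrit (hL ▸ hτI), ← hL, infLoss_eq hL0 hτI0, hz]
      ring
    rw [hN]
    refine sInf_natCast_eq_top fun n hn => ?_
    have hle := hn.2
    rw [htop] at hle
    exact absurd hle (not_le.2
      (companyLoss_pos hγ hδ hρ0 hρ h (hL ▸ (by linarith : 9 / 16 * L ≤ τE)) hn.1))
  · have hsuff' : ∀ n : ℕ, Reaches (nu γ δ) μ c₁ C₀ X D n →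
        1 ≤ n ∧ companyLoss DF DW n τE ≤ companyLoss DF DW ⊤ τI := fun n hn =>
      ⟨hn.1, hsuff ρ hρ0 hρ DF DW h τI τE (discount L τE) D (hL ▸ hτI) hτ (by rw [hL])
        (by rw [hD', hL]) n (hXe ▸ hn)⟩
    have hsuff'' : δ ≠ 1 → ∀ n : ℕ, Reaches (nu γ δ) (nu' γ δ) c₁ C₀ X D n →
        1 ≤ n ∧ companyLoss DF DW n τE ≤ companyLoss DF DW ⊤ τI := fun h1 n hn =>
      hsuff' n (by rw [hμν h1]; exact hn)
    obtain ⟨n₁, hn₁⟩ := exists_reaches_of_pos hν hμ hc₁ hC₀ hDp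
    obtain ⟨n, hnN, ⟨hn1, hnle⟩, hmin⟩ := sInf_natCast_eq
      (p := fun n : ℕ => 1 ≤ n ∧ companyLoss DF DW n τE ≤ companyLoss DF DW ⊤ τI)
      ⟨n₁, hsuff' n₁ hn₁⟩
    have hreach : Reaches (nu γ δ) (nu' γ δ) 8 c₀ X D n := by
      rw [hXe]
      exact hnec ρ hρ0 hρ DF DW h τI τE (discount L τE) D (hL ▸ hτI) hτ (by rw [hL])
        (by rw [hD', hL]) hDp n hn1 hnle
    refine ⟨n, by rw [hN]; exact hnN, fun hXD => ?_, fun h1 hlow hDX => ?_, fun h1 hDX => ?_⟩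
    · rw [hνdef]
      have hT : 0 ≤ D ^ (-(1 / nu γ δ)) := by positivity
      obtain ⟨m, hm, hmle⟩ := hu1 X D hX0 hDp hDM hXD
      have hnm : (n : ℝ) ≤ m := by exact_mod_cast hmin m (hsuff' m hm)
      exact ⟨(mul_le_mul_of_nonneg_right hcl₁ hT).trans
        (hreach.rpow_le hν hc₀ (by norm_num) hX0 hDp),
        hnm.trans (hmle.trans (mul_le_mul_of_nonneg_right hCU₁ hT))⟩
    · rw [mul_assoc (D ^ _), ← hX, hνdef]
      have hT : 0 ≤ D ^ (-((nu γ δ + 1) / nu γ δ)) * X := by positivity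
      -- For δ < 1 the two exponents agree and X ≤ M suffices, which is why the regime has no lower
      -- boundary; for δ > 1 the boundary provides the bound.
      have hcond : X * D ^ (nu' γ δ / nu γ δ) ≤ M * D := by
        rcases lt_or_gt_of_ne h1 with h2 | h2
        · rw [nu_eq_nu' hγ h2, div_self hν'.ne', Real.rpow_one]
          gcongr
        · have h3 := hlow h2
          have hsub := nu'_lt_nu hγ h2
          have h4 : X ^ (nu γ δ / (nu γ δ - nu' γ δ)) ≤ D := by
            refine le_trans (le_of_eq ?_) h3
            rw [hX, mul_rpow_half_rpow hGE0 hs.le, hνdef, hν'def]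
          refine (mul_rpow_le_of_rpow_le hν' hsub hX0 hDp h4).trans ?_
          exact le_mul_of_one_le_left hD0 hM1
      obtain ⟨m, hm, hmle⟩ := hu2 X D hDp hDM hDX hcond
      have hnm : (n : ℝ) ≤ m := by exact_mod_cast hmin m (hsuff'' h1 m hm)
      exact ⟨(mul_le_mul_of_nonneg_right hcl₂ hT).trans
        (hreach.penalty_rpow_le hν hc₀ hX0 hDp),
        hnm.trans (hmle.trans (mul_le_mul_of_nonneg_right hCU₂ hT))⟩
    · have hsub := nu'_lt_nu hγ h1
      have hpos : 0 < nu γ δ / (nu γ δ - nu' γ δ) := div_pos hν (by linarith)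
      have hDX' : D ≤ X ^ (nu γ δ / (nu γ δ - nu' γ δ)) := by
        refine hDX.trans (le_of_eq ?_)
        rw [hX, mul_rpow_half_rpow hGE0 hs.le, hνdef, hν'def]
      -- Without a mixing penalty the third regime would force D ≤ 0.
      have hXp : 0 < X := by
        refine hX0.lt_of_ne fun h0 => ?_
        rw [← h0, Real.zero_rpow hpos.ne'] at hDX'
        linarith
      have hratio : D * GE ^ (-(1 / 2) : ℝ) * (1 - ρ) ^ (-(1 / 2) : ℝ) = D / X := by
        rw [hX, Real.rpow_neg hGE0, Real.rpow_neg hs.le, mul_assoc, ← mul_inv]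
        exact (div_eq_mul_inv _ _).symm
      rw [hratio, hν'def]
      have hT : 0 ≤ (D / X) ^ (-((nu' γ δ + 1) / nu' γ δ)) := by positivity
      obtain ⟨m, hm, hmle⟩ := hu3 h1 X D hXp hXM hDp hDX'
      have hnm : (n : ℝ) ≤ m := by exact_mod_cast hmin m (hsuff'' h1.ne' m hm)
      exact ⟨(mul_le_mul_of_nonneg_right hcl₃ hT).trans
        (hreach.ratio_rpow_le hν' hc₀ hXp hDp),
        hnm.trans (hmle.trans (mul_le_mul_of_nonneg_right hCU₃ hT))⟩
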